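/- Let $T$ be the closed nonconvex equilateral 7-gon obtained from a regular heptagon by replacing a chain of three consecutive edges by its mirror image in the chord joining the two ends of this chain. So the boundary of $T$ consists of a "convex side" of four edges (with three inner angles $5\pi/7$) and a "concave side" of three edges (with two inner angles $9\pi/7$), which meet in two acute vertices with inner angle $\pi/7$. A monohedral tiling by $T$ is a countable family of sets congruent to $T$ (reflected copies allowed) that covers the plane without overlaps of nonzero area. In a monohedral tiling by $T$ none of the following constellations of two tiles occurs, nor any congruent or mirrored copy of one of them: (a) An acute vertex of a (white) tile lies at a reflex vertex $p$ of another (dark) tile, and the two tiles share the edge of the dark tile that joins $p$ to its neighbouring acute vertex; this edge is the first edge of the convex side of the white tile. (This leaves an open angle of $4\pi/7$ at $p$.) (b) Two tiles share an acute vertex $p$, turn their concave sides towards each other, and the edges of their concave sides at $p$ enclose an open angle of $5\pi/7$. (c) The same as (b), with an open angle of $6\pi/7$. (d) The same as (b), with an open angle of $\pi$. -/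

import Mathlib

open Complex MeasureTheory
open scoped ComplexConjugate

/-! ### Tilings of the Euclidean plane `ℂ` -/

/-- `A` is a congruent copy of `P`: an image of `P` under an isometry of the plane
(reflections are allowed). -/
def IsCopy (P A : Set ℂ) : Prop := ∃ f : ℂ ≃ᵢ ℂ, A = f '' P

/-- A monohedral tiling with prototile `P`: a countable family of congruent copies of `P` that
covers the plane, two different tiles never overlapping in a set of nonzero area. -/
structure IsMonohedralTiling (P : Set ℂ) (𝒯 : Set (Set ℂ)) : Prop where
  countable : 𝒯.Countable
  copies : ∀ A ∈ 𝒯, IsCopy P A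
  covers : ⋃₀ 𝒯 = Set.univ
  no_overlap : ∀ A ∈ 𝒯, ∀ B ∈ 𝒯, A ≠ B → volume (A ∩ B) = 0

/-- A constellation `K` (a set of placed tiles) occurs in the tiling `𝒯` if some congruent copy
of the whole constellation (possibly a reflected one) consists of tiles of `𝒯`. -/
def Occurs (K 𝒯 : Set (Set ℂ)) : Prop := ∃ f : ℂ ≃ᵢ ℂ, ∀ A ∈ K, f '' A ∈ 𝒯

namespace HeptagonTile

/-! ### The tile -/

/-- The first seventh root of unity. -/
noncomputable def ζ : ℂ := exp (2 * Real.pi * I / 7)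

/-- The filled regular heptagon with the vertices `ζ ^ k`. -/
noncomputable def heptagon : Set ℂ := convexHull ℝ (Set.range fun k : Fin 7 => ζ ^ (k : ℕ))

/-- Reflection of the plane in the (vertical) line through `ζ ^ 2` and `ζ ^ 5 = conj (ζ ^ 2)`.
This chord of the heptagon cuts off the three edges `ζ ^ 2, ζ ^ 3, ζ ^ 4, ζ ^ 5`. -/
noncomputable def chordReflection (z : ℂ) : ℂ := 2 * ((ζ ^ 2).re : ℂ) - conj z

/-- The tile `T`, a reflexed regular heptagon: the regular heptagon in which the chain of three
consecutive edges is replaced by its mirror image in the chord joining the ends of the chain.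
It is a nonconvex equilateral 7-gon.  Its convex side is the chain of four edges
`ζ ^ 5, ζ ^ 6, 1, ζ, ζ ^ 2`, with inner angles `5π/7` at `ζ ^ 6, 1, ζ`; its concave side is the
chain of three edges `ζ ^ 5, chordReflection (ζ ^ 4), chordReflection (ζ ^ 3), ζ ^ 2`, with inner
angles `9π/7` at the two middle points; the inner angles at the acute vertices `ζ ^ 2, ζ ^ 5`
are `π/7`. -/
noncomputable def T : Set ℂ := closure (heptagon \ chordReflection '' heptagon)

/-- An acute vertex of `T` (the other one is its mirror image under the symmetry `conj` of
`T`). -/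
noncomputable def tip : ℂ := ζ ^ 2

/-- The reflex vertex of `T` next to `tip`. -/
noncomputable def reflexVertex : ℂ := chordReflection (ζ ^ 3)

/-! ### The constellations -/

/-- The white tile of constellation a.  The dark tile is `T`.  The white tile has its convex side on
the boundary of the mirrored heptagon `chordReflection '' heptagon`, which is the heptagon that the
concave side of `T` belongs to; along its convex side, its vertices are
`chordReflection (ζ ^ k)`, `k = 3, 2, 1, 0, -1`.  So its acute vertex lies at the reflex vertex
`p = reflexVertex` of `T`, and the first edge of its convex side is the edge from `p` to `tip` of
`T`. This leaves at `p` the open angle `14π/7 - 9π/7 - π/7 = 4π/7`. -/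
noncomputable def whiteTile : Set ℂ := (fun z => chordReflection (ζ * z)) '' T

/-- Constellation a. -/
noncomputable def constellationA : Set (Set ℂ) := {T, whiteTile}

/-- Reflection in the line that carries the edge of the concave side of `T` at `tip`, followed by
the clockwise rotation about `tip` by the angle `m * π/7`. -/
noncomputable def flipTurn (m : ℕ) (z : ℂ) : ℂ :=
  tip + exp (-(m * Real.pi / 7 : ℝ) * I) *
    ((reflexVertex - tip) / conj (reflexVertex - tip)) * conj (z - tip)

/-- Two copies of the tile with a common acute vertex `p = tip`, which turn their concave sides
towards each other and enclose at `p`, between the edges of their concave sides, the open angle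
`m * π/7`.  (`T` lies to the left of the ray from `tip` through `reflexVertex`, so its mirror image
in the line of that ray is turned clockwise, away from `T`.) -/
noncomputable def facingPair (m : ℕ) : Set (Set ℂ) := {T, flipTurn m '' T}

/-- Constellation b: open angle `5π/7`. -/
noncomputable def constellationB : Set (Set ℂ) := facingPair 5

/-- Constellation c: open angle `6π/7`. -/
noncomputable def constellationC : Set (Set ℂ) := facingPair 6

/-- Constellation d: open angle `π`. -/
noncomputable def constellationD : Set (Set ℂ) := facingPair 7

/-! ### The maps above are isometries, so that the constellations consist of copies of `T` -/

theorem norm_ζ : ‖ζ‖ = 1 := by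
  have : ζ = exp ((2 * Real.pi / 7 : ℝ) * I) := by unfold ζ; congr 1; push_cast; ring
  rw [this]; exact Complex.norm_exp_ofReal_mul_I _

theorem isometry_chordReflection : Isometry chordReflection := by
  refine Isometry.of_dist_eq fun z w => ?_
  simp only [chordReflection, dist_sub_left]
  exact Complex.isometry_conj.dist_eq z w

theorem isometry_whiteMap : Isometry fun z => chordReflection (ζ * z) := by
  refine isometry_chordReflection.comp (Isometry.of_dist_eq fun z w => ?_)
  rw [dist_eq_norm, ← mul_sub, norm_mul, norm_ζ, one_mul, dist_eq_norm]

theorem reflexVertex_ne_tip : reflexVertex ≠ tip := by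
  have h1 : chordReflection tip = tip := by
    unfold chordReflection tip
    generalize ζ ^ 2 = w
    apply Complex.ext <;> simp
    ring
  rw [← h1]
  intro h
  have h2 : ζ ^ 3 = ζ ^ 2 := isometry_chordReflection.injective h
  have h0 : ζ ≠ 0 := Complex.exp_ne_zero _
  have h3 : ζ = 1 := by
    have : ζ ^ 2 * (ζ - 1) = 0 := by linear_combination h2
    rcases mul_eq_zero.1 this with h | h
    · exact absurd h (pow_ne_zero _ h0)
    · linear_combination h
  have := (Complex.isPrimitiveRoot_exp 7 (by norm_num)).ne_one (by norm_num)
  exact this (by simpa [ζ] using h3)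

theorem isometry_flipTurn (m : ℕ) : Isometry (flipTurn m) := by
  refine Isometry.of_dist_eq fun z w => ?_
  have h : ‖reflexVertex - tip‖ ≠ 0 := norm_ne_zero_iff.2 (sub_ne_zero.2 reflexVertex_ne_tip)
  have e : ‖exp (-(m * Real.pi / 7 : ℝ) * I)‖ = 1 := by
    have := Complex.norm_exp_ofReal_mul_I (-(m * Real.pi / 7))
    simpa using this
  simp only [flipTurn, dist_add_left]
  rw [dist_eq_norm, ← mul_sub, norm_mul, norm_mul, e, norm_div, RCLike.norm_conj, div_self h,
    ← map_sub, RCLike.norm_conj, dist_eq_norm]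
  simp
end HeptagonTile

/-! The inner angles of the tile are π/7, 5π/7 and 9π/7, and a point inside an edge contributes π,
so the angles at a point can be counted in units of π/7. Along a ray on the boundary of one tile,
another tile starts on the other side (`exists_next`), and its angle must fit into the angle that is
left open (`not_start_in_angle`). The tiling need not be edge to edge, so interior points of edges
have to be allowed for. Since the tile has a mirror symmetry, every reflected copy is also a direct
one, and all tiles have the form `tile p w`.

An open angle of at most 4π/7 can only be filled with acute angles, each lying between a convex and
a concave edge. Two concave edges with reflex far ends, lying on opposite sides of the same segment,
cannot coincide, because 9 + 9 > 14 (`not_reflex_reflex`). So if the first arm of the wedge is such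
a concave edge, the next acute tile must turn its convex edge towards it and offers its own concave
edge to its successor. At the second arm two concave edges finally collide if that arm is concave as
well (`no_wedge`). This is constellation a.

In constellation b, starting the filling with an acute angle leads to one of these contradictions.
Otherwise a single angle 5π/7 fills the gap. If it belongs to an outer obtuse vertex, constellation
a appears. If it belongs to the middle one, the acute vertex of the inserted tile meets the second
reflex vertex of one of the two given tiles. The acute angles in the wedge left there are forced to
have one orientation (`last_in_wedge`), and the last of these tiles overlaps the other given tile.

Constellations c and d are reduced to smaller open angles by removing an acute tile (`facing_step`).
In d an edge may also pass straight through the common vertex. It then ends inside an edge of the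
facing tile, and either its own tile or the tile that continues along that edge penetrates the
facing tile. -/

namespace HeptagonTile

open Filter Topology

/-! ### The fourteenth roots of unity -/

/-- The rotation by `π / 7`. -/
noncomputable def ω : ℂ := exp (Real.pi * I / 7)

theorem ω_pow_seven : ω ^ 7 = -1 := by
  rw [ω, ← Complex.exp_nat_mul, ← Complex.exp_pi_mul_I]
  congr 1
  push_cast
  ring

theorem ω_pow_fourteen : ω ^ 14 = 1 := by
  linear_combination (ω ^ 7 - 1) * ω_pow_seven

theorem ω_ne_zero : ω ≠ 0 := Complex.exp_ne_zero _

theorem norm_ω : ‖ω‖ = 1 := by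
  have : ω = exp ((Real.pi / 7 : ℝ) * I) := by unfold ω; congr 1; push_cast; ring
  rw [this]; exact Complex.norm_exp_ofReal_mul_I _

theorem ω_sq : ω ^ 2 = ζ := by
  rw [ω, ζ, ← Complex.exp_nat_mul]
  congr 1
  push_cast
  ring

theorem conj_ω : conj ω = ω ^ 13 := by
  have h : conj ω * ω = 1 := by
    rw [mul_comm, Complex.mul_conj, Complex.normSq_eq_norm_sq, norm_ω]; simp
  apply mul_right_cancel₀ ω_ne_zero
  rw [h]
  linear_combination - ω_pow_fourteen

theorem ω_im (n : ℕ) : (ω ^ n).im = Real.sin (n * (Real.pi / 7)) := by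
  have : ω ^ n = exp ((n * (Real.pi / 7) : ℝ) * I) := by
    rw [ω, ← Complex.exp_nat_mul]; congr 1; push_cast; ring
  rw [this, Complex.exp_ofReal_mul_I_im]

noncomputable def s₁ : ℝ := Real.sin (Real.pi / 7)
noncomputable def s₂ : ℝ := Real.sin (2 * (Real.pi / 7))
noncomputable def s₃ : ℝ := Real.sin (3 * (Real.pi / 7))

theorem s₁_pos : 0 < s₁ :=
  Real.sin_pos_of_pos_of_lt_pi (by positivity) (by linarith [Real.pi_pos])

theorem s₁_lt_s₂ : s₁ < s₂ :=
  Real.sin_lt_sin_of_lt_of_le_pi_div_two (by linarith [Real.pi_pos]) (by linarith [Real.pi_pos])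
    (by linarith [Real.pi_pos])

theorem s₂_lt_s₃ : s₂ < s₃ :=
  Real.sin_lt_sin_of_lt_of_le_pi_div_two (by linarith [Real.pi_pos]) (by linarith [Real.pi_pos])
    (by linarith [Real.pi_pos])

theorem s₂_pos : 0 < s₂ := s₁_pos.trans s₁_lt_s₂

theorem s₃_pos : 0 < s₃ := s₂_pos.trans s₂_lt_s₃

theorem ω_im_1 : ω.im = s₁ := by
  have := ω_im 1
  simpa [s₁] using this

theorem ω_im_2 : (ω ^ 2).im = s₂ := by
  simpa [s₂] using ω_im 2

theorem ω_im_3 : (ω ^ 3).im = s₃ := by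
  simpa [s₃] using ω_im 3

theorem ω_im_4 : (ω ^ 4).im = s₃ := by
  rw [ω_im, s₃, ← Real.sin_pi_sub]
  congr 1
  push_cast
  ring

theorem ω_im_5 : (ω ^ 5).im = s₂ := by
  rw [ω_im, s₂, ← Real.sin_pi_sub]
  congr 1
  push_cast
  ring

theorem ω_im_6 : (ω ^ 6).im = s₁ := by
  rw [ω_im, s₁, ← Real.sin_pi_sub]
  congr 1
  push_cast
  ring

theorem ω_im_pos {n : ℕ} (h0 : 0 < n) (h7 : n < 7) : 0 < (ω ^ n).im := by
  rw [ω_im]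
  have h0' : (0 : ℝ) < n := by exact_mod_cast h0
  have h7' : (n : ℝ) < 7 := by exact_mod_cast h7
  exact Real.sin_pos_of_pos_of_lt_pi (by positivity) (by nlinarith [Real.pi_pos])

/-- Reduction of the powers of `ω` to exponents below `7`. -/
theorem ω_pow_add_seven (n : ℕ) : ω ^ (n + 7) = -ω ^ n := by
  linear_combination ω ^ n * ω_pow_seven

theorem ω_pow_8 : ω ^ 8 = -ω := by simpa using ω_pow_add_seven 1
theorem ω_pow_9 : ω ^ 9 = -ω ^ 2 := ω_pow_add_seven 2
theorem ω_pow_10 : ω ^ 10 = -ω ^ 3 := ω_pow_add_seven 3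
theorem ω_pow_11 : ω ^ 11 = -ω ^ 4 := ω_pow_add_seven 4
theorem ω_pow_12 : ω ^ 12 = -ω ^ 5 := ω_pow_add_seven 5
theorem ω_pow_13 : ω ^ 13 = -ω ^ 6 := ω_pow_add_seven 6
theorem ω_pow_16 : ω ^ 16 = ω ^ 2 := by linear_combination ω ^ 2 * ω_pow_fourteen

/-- The double cosine of `π / 7`, less one. -/
noncomputable def κ : ℝ := 2 * Real.cos (Real.pi / 7) - 1

theorem κ_pos : 0 < κ := by
  have : Real.cos (Real.pi / 3) < Real.cos (Real.pi / 7) :=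
    Real.cos_lt_cos_of_nonneg_of_le_pi_div_two (by positivity) (by linarith [Real.pi_pos])
      (by linarith [Real.pi_pos])
  rw [Real.cos_pi_div_three] at this
  unfold κ; linarith

/-- Multiply `ω + conj ω = 2 cos (π/7)` by `ω`. It exhibits `κ + 1` as the length of the short
diagonal of the heptagon with unit edges. -/
theorem one_add_ω_sq : 1 + ω ^ 2 = (κ + 1) * ω := by
  have h : ω + conj ω = (κ : ℂ) + 1 := by
    rw [Complex.add_conj]
    have : ω = exp ((Real.pi / 7 : ℝ) * I) := by unfold ω; congr 1; push_cast; ring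
    rw [this, Complex.exp_ofReal_mul_I_re, κ]
    push_cast; ring
  rw [conj_ω] at h
  linear_combination ω * h - ω_pow_fourteen

theorem cyclotomic : 1 - ω + ω ^ 2 - ω ^ 3 + ω ^ 4 - ω ^ 5 + ω ^ 6 = 0 := by
  have h1 : 1 + ω ≠ 0 := by
    intro h
    have := congrArg Complex.im h
    simp [ω_im_1] at this
    exact s₁_pos.ne' this
  apply mul_left_cancel₀ h1
  linear_combination ω_pow_seven

/-! ### The tile, normalized to unit edges -/

/-- The direction of the edge `j` of the normalized tile is `ω ^ dir j`. -/
def dir : Fin 7 → ℕ := ![0, 2, 8, 6, 4, 10, 12]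

/-- The inner angle at the vertex `j` is `ang j * π / 7`. -/
def ang : Fin 7 → ℕ := ![5, 5, 1, 9, 9, 1, 5]

/-- The vertices of the normalized tile in counterclockwise order. -/
noncomputable def vert : Fin 7 → ℂ :=
  ![0, 1, 1 + ω ^ 2, 1 + ω ^ 2 - ω, ω ^ 5 + ω ^ 3 - ω ^ 4, ω ^ 5 + ω ^ 3, ω ^ 5]

/-- The affine function that vanishes on the edge `j` and is positive to the left of it. -/
noncomputable def side (j : Fin 7) (z : ℂ) : ℝ := (ω ^ (14 - dir j) * (z - vert j)).im

theorem side_0 (z : ℂ) : side 0 z = z.im := by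
  simp [side, dir, vert, ω_pow_fourteen]

theorem side_1 (z : ℂ) : side 1 z = -(ω ^ 5 * z).im + s₂ := by
  simp only [side, dir, vert, Matrix.cons_val]
  norm_num only
  rw [ω_pow_12, ← ω_im_5, ← Complex.neg_im, ← Complex.add_im]
  congr 1; ring

theorem side_2 (z : ℂ) : side 2 z = (ω ^ 6 * z).im := by
  simp only [side, dir, vert, Matrix.cons_val]
  norm_num only
  have : ω ^ 6 * (z - (1 + ω ^ 2)) = ω ^ 6 * z + (κ + 1 : ℝ) := by
    push_cast; linear_combination -ω ^ 6 * one_add_ω_sq - (κ + 1) * ω_pow_seven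
  rw [this, Complex.add_im, Complex.ofReal_im, add_zero]

theorem side_3 (z : ℂ) : side 3 z = -(ω * z).im + κ * s₂ := by
  simp only [side, dir, vert, Matrix.cons_val]
  norm_num only
  have : ω ^ 8 * (z - (1 + ω ^ 2 - ω)) = - (ω * z) + κ * ω ^ 2 := by
    linear_combination (z-κ * ω) * ω * ω_pow_seven - ω ^ 8 * one_add_ω_sq
  rw [this, Complex.add_im, Complex.im_ofReal_mul, ω_im_2, Complex.neg_im]

theorem side_4 (z : ℂ) : side 4 z = -(ω ^ 3 * z).im := by
  simp only [side, dir, vert, Matrix.cons_val]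
  norm_num only
  have : ω ^ 10 * (z - (ω ^ 5 + ω ^ 3 - ω ^ 4)) = - (ω ^ 3 * z) - (κ : ℝ) := by
    linear_combination ω ^ 3 * z * ω_pow_seven - ω ^ 13 * one_add_ω_sq
      - κ * ω_pow_fourteen
  rw [this, Complex.sub_im, Complex.ofReal_im, sub_zero, Complex.neg_im]

theorem side_5 (z : ℂ) : side 5 z = (ω ^ 4 * z).im + s₂ := by
  simp only [side, dir, vert, Matrix.cons_val]
  norm_num only
  have : ω ^ 4 * (z - (ω ^ 5 + ω ^ 3)) = ω ^ 4 * z + 1 + ω ^ 2 := by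
    linear_combination -(1 + ω ^ 2) * ω_pow_seven
  rw [this, Complex.add_im, Complex.add_im, ω_im_2]; simp

theorem side_6 (z : ℂ) : side 6 z = (ω ^ 2 * z).im := by
  simp only [side, dir, vert, Matrix.cons_val]
  norm_num only
  have : ω ^ 2 * (z - ω ^ 5) = ω ^ 2 * z + 1 := by
    linear_combination - ω_pow_seven
  rw [this, Complex.add_im]; simp

/-- The normalized tile: bounded by its four convex edges, and beyond one of the three concave
edges. -/
def P : Set ℂ := {z | 0 ≤ side 0 z ∧ 0 ≤ side 1 z ∧ 0 ≤ side 5 z ∧ 0 ≤ side 6 z ∧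
  (0 ≤ side 2 z ∨ 0 ≤ side 3 z ∨ 0 ≤ side 4 z)}

/-- The interior of the normalized tile. -/
def Pint : Set ℂ := {z | 0 < side 0 z ∧ 0 < side 1 z ∧ 0 < side 5 z ∧ 0 < side 6 z ∧
  (0 < side 2 z ∨ 0 < side 3 z ∨ 0 < side 4 z)}

/-! ### Affine behaviour of the side functions, closed tile and open interior. -/

theorem continuous_side (j : Fin 7) : Continuous (side j) := by
  unfold side; fun_prop

theorem side_lineMap (j : Fin 7) (z c : ℂ) (t : ℝ) :
    side j (z + t * (c - z)) = (1 - t) * side j z + t * side j c := by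
  unfold side
  have : ω ^ (14 - dir j) * (z + t * (c - z) - vert j) =
      ((1 - t : ℝ) : ℂ) * (ω ^ (14 - dir j) * (z - vert j))
        + (t : ℂ) * (ω ^ (14 - dir j) * (c - vert j)) := by
    push_cast; ring
  rw [this, Complex.add_im, Complex.im_ofReal_mul, Complex.im_ofReal_mul]

theorem side_add_mul (j : Fin 7) (z d : ℂ) (r : ℝ) :
    side j (z + r * d) = side j z + r * (ω ^ (14 - dir j) * d).im := by
  unfold side
  have : ω ^ (14 - dir j) * (z + r * d - vert j) =
      (ω ^ (14 - dir j) * (z - vert j)) + (r : ℂ) * (ω ^ (14 - dir j) * d) := by ring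
  rw [this, Complex.add_im, Complex.im_ofReal_mul]

theorem ω_pow_dir_mul (j : Fin 7) : ω ^ (14 - dir j) * ω ^ dir j = 1 := by
  rw [← pow_add, ← ω_pow_fourteen]; congr 1; fin_cases j <;> rfl

theorem isClosed_P : IsClosed P := by
  have h := fun j => isClosed_le continuous_const (continuous_side j) (f := fun _ => (0 : ℝ))
  exact (h 0).inter ((h 1).inter ((h 5).inter ((h 6).inter ((h 2).union ((h 3).union (h 4))))))

theorem isOpen_Pint : IsOpen Pint := by
  have h := fun j => isOpen_lt continuous_const (continuous_side j) (f := fun _ => (0 : ℝ))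
  exact (h 0).inter ((h 1).inter ((h 5).inter ((h 6).inter ((h 2).union ((h 3).union (h 4))))))

theorem Pint_subset_P : Pint ⊆ P := by
  rintro z ⟨h0, h1, h5, h6, h⟩
  exact ⟨h0.le, h1.le, h5.le, h6.le, h.imp le_of_lt (Or.imp le_of_lt le_of_lt)⟩

theorem Pint_subset_interior : Pint ⊆ interior P := interior_maximal Pint_subset_P isOpen_Pint

/-- The coordinates with respect to the basis `ω`, `ω ^ 4`, in which the sides of the tile have
simple equations. -/
theorem exists_coord (z : ℂ) : ∃ a b : ℝ, z = a * ω + b * ω ^ 4 := by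
  have h3 := s₃_pos.ne'
  refine ⟨(ω ^ 3 * z).im / s₃, -(ω ^ 6 * z).im / s₃, ?_⟩
  have e1 : ω ^ 3 * ω = ω ^ 4 := by ring
  have e2 : ω ^ 3 * ω ^ 4 = -1 := by rw [← ω_pow_seven]; ring
  have e3 : ω ^ 6 * ω = -1 := by rw [← ω_pow_seven]; ring
  have e4 : ω ^ 6 * ω ^ 4 = -ω ^ 3 := by rw [← ω_pow_10]; ring
  set a := (ω ^ 3 * z).im / s₃
  set b := -(ω ^ 6 * z).im / s₃
  set w := z - (a * ω + b * ω ^ 4) with hw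
  have k1 : (ω ^ 3 * w).im = 0 := by
    have : ω ^ 3 * w = ω ^ 3 * z - (a * ω ^ 4 - (b : ℝ)) := by
      rw [hw]; linear_combination -(a : ℂ) * e1 - (b : ℂ) * e2
    rw [this]
    simp only [Complex.sub_im, Complex.im_ofReal_mul, ω_im_4, Complex.ofReal_im, a]
    field_simp; ring
  have k2 : (ω ^ 6 * w).im = 0 := by
    have : ω ^ 6 * w = ω ^ 6 * z - (-(a : ℝ) - b * ω ^ 3) := by
      rw [hw]; linear_combination -(a : ℂ) * e3 - (b : ℂ) * e4
    rw [this]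
    simp only [Complex.sub_im, Complex.im_ofReal_mul, ω_im_3, Complex.ofReal_im, b, Complex.neg_im]
    field_simp; ring
  have k3 : ω ^ 3 * w = ((ω ^ 3 * w).re : ℂ) := Complex.ext rfl (by simp [k1])
  have k4 : ω ^ 6 * w = ((ω ^ 3 * w).re : ℂ) * ω ^ 3 := by rw [← k3]; ring
  rw [k4, Complex.im_ofReal_mul, ω_im_3] at k2
  have k5 : (ω ^ 3 * w).re = 0 := by simpa [h3] using k2
  rw [k5] at k3
  have k6 : w = 0 := by simpa [ω_ne_zero] using k3
  rw [hw, sub_eq_zero] at k6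
  exact k6

/-! ### The sides in oblique coordinates: edges 2 and 4 lie on the axes, edge 3 on a + b = κ. -/

section coord
variable (a b : ℝ)

theorem side_0_coord : side 0 (a * ω + b * ω ^ 4) = a * s₁ + b * s₃ := by
  simp only [side_0, Complex.add_im, Complex.im_ofReal_mul, ω_im_1, ω_im_4]

theorem side_1_coord : side 1 (a * ω + b * ω ^ 4) = s₂ + b * s₂ - a * s₁ := by
  have : ω ^ 5 * (a * ω + b * ω ^ 4) = a * ω ^ 6 - b * ω ^ 2 := by
    linear_combination b * ω_pow_9
  rw [side_1, this]
  simp only [Complex.sub_im, Complex.im_ofReal_mul, ω_im_2, ω_im_6]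
  ring

theorem side_2_coord : side 2 (a * ω + b * ω ^ 4) = - b * s₃ := by
  have : ω ^ 6 * (a * ω + b * ω ^ 4) = -(a : ℝ) - b * ω ^ 3 := by
    linear_combination b * ω_pow_10 + a * ω_pow_seven
  rw [side_2, this]
  simp only [Complex.sub_im, Complex.im_ofReal_mul, ω_im_3, Complex.neg_im, Complex.ofReal_im]
  ring

theorem side_3_coord : side 3 (a * ω + b * ω ^ 4) = (κ - a - b) * s₂ := by
  have : ω * (a * ω + b * ω ^ 4) = a * ω ^ 2 + b * ω ^ 5 := by ring
  rw [side_3, this]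
  simp only [Complex.add_im, Complex.im_ofReal_mul, ω_im_2, ω_im_5]
  ring

theorem side_4_coord : side 4 (a * ω + b * ω ^ 4) = - a * s₃ := by
  have : ω ^ 3 * (a * ω + b * ω ^ 4) = a * ω ^ 4 - (b : ℝ) := by
    linear_combination b * ω_pow_seven
  rw [side_4, this]
  simp only [Complex.sub_im, Complex.im_ofReal_mul, ω_im_4, Complex.ofReal_im]
  ring

theorem side_5_coord : side 5 (a * ω + b * ω ^ 4) = s₂ + a * s₂ - b * s₁ := by
  have : ω ^ 4 * (a * ω + b * ω ^ 4) = a * ω ^ 5 - b * ω := by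
    linear_combination b * ω_pow_8
  rw [side_5, this]
  simp only [Complex.sub_im, Complex.im_ofReal_mul, ω_im_5, ω_im_1]
  ring

theorem side_6_coord : side 6 (a * ω + b * ω ^ 4) = a * s₃ + b * s₁ := by
  have : ω ^ 2 * (a * ω + b * ω ^ 4) = a * ω ^ 3 + b * ω ^ 6 := by ring
  rw [side_6, this]
  simp only [Complex.add_im, Complex.im_ofReal_mul, ω_im_3, ω_im_6]

end coord

theorem κ_add_one_mul_s₁ : (κ + 1) * s₁ = s₂ := by
  have := congrArg Complex.im one_add_ω_sq
  rw [Complex.add_im, ω_im_2, show ((κ : ℂ) + 1) = ((κ + 1 : ℝ) : ℂ) by push_cast; rfl,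
    Complex.im_ofReal_mul, ω_im_1] at this
  simpa using this.symm

/-- Every point of the tile is a limit of interior points. -/
theorem P_subset_closure_Pint : P ⊆ closure Pint := by
  have h1 := s₁_pos
  have h2 := s₂_pos
  have h3 := s₃_pos
  have h12 := s₁_lt_s₂
  have h23 := s₂_lt_s₃
  have hκ := κ_pos
  -- The tile is a union of three convex pieces, one for each concave side; `z` is approached along
  -- a segment from a point `c` strictly inside its piece.
  have key : ∀ z c : ℂ, (∀ t : ℝ, 0 < t → t < 1 → z + t * (c - z) ∈ Pint) → z ∈ closure Pint := by
    intro z c h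
    have lim : Tendsto (fun t : ℝ => z + t * (c - z)) (𝓝[>] 0) (𝓝 z) := by
      have : Continuous (fun t : ℝ => z + t * (c - z)) := by fun_prop
      have := this.tendsto 0
      simp only [Complex.ofReal_zero, zero_mul, add_zero] at this
      exact this.mono_left nhdsWithin_le_nhds
    refine mem_closure_of_tendsto lim ?_
    have : Set.Ioo (0 : ℝ) 1 ∈ 𝓝[>] (0 : ℝ) := Ioo_mem_nhdsGT one_pos
    filter_upwards [this] with t ht using h t ht.1 ht.2
  have comb : ∀ (j : Fin 7) (z c : ℂ) (t : ℝ), 0 < t → t < 1 → 0 ≤ side j z → 0 < side j c →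
      0 < side j (z + t * (c - z)) := by
    intro j z c t h0 h1 hz hc
    rw [side_lineMap]
    have := mul_nonneg (sub_pos.2 h1).le hz
    have := mul_pos h0 hc
    linarith
  obtain ⟨δ, hδ, hδκ, hδ1⟩ : ∃ δ : ℝ, 0 < δ ∧ δ < κ ∧ δ < 1 / 2 :=
    ⟨min κ 1 / 3, by positivity, by linarith [min_le_left κ 1, lt_min hκ one_pos],
      by linarith [min_le_right κ 1, lt_min hκ one_pos]⟩
  rintro z ⟨z0, z1, z5, z6, z2 | z3 | z4⟩
  -- The value of `β` keeps side 0 of `c` at δ s₁ / 2, while the negative second coordinate makes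
  -- side 2 positive.
  · set β := δ * s₁ / (2 * s₃)
    have hβ : β * s₃ = δ * s₁ / 2 := by simp only [β]; field_simp
    have hβ0 : 0 < β := by positivity
    have hβ1 : β < δ := by
      have : β * s₃ < δ * s₃ := by rw [hβ]; nlinarith
      exact lt_of_mul_lt_mul_right this h3.le
    have c0 : 0 < side 0 (δ * ω + (-β : ℝ) * ω ^ 4) := by
      rw [side_0_coord]; nlinarith
    have c1 : 0 < side 1 (δ * ω + (-β : ℝ) * ω ^ 4) := by
      rw [side_1_coord, ← κ_add_one_mul_s₁]
      have h4 : δ + β * (κ + 1) < κ + 1 := by nlinarith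
      nlinarith [mul_lt_mul_of_pos_right h4 h1]
    have c5 : 0 < side 5 (δ * ω + (-β : ℝ) * ω ^ 4) := by
      rw [side_5_coord]; nlinarith [mul_pos hδ h2, mul_pos hβ0 h1]
    have c6 : 0 < side 6 (δ * ω + (-β : ℝ) * ω ^ 4) := by
      rw [side_6_coord]; nlinarith
    have c2 : 0 < side 2 (δ * ω + (-β : ℝ) * ω ^ 4) := by
      rw [side_2_coord]; nlinarith
    exact key z _ fun t t0 t1 => ⟨comb _ _ _ _ t0 t1 z0 c0, comb _ _ _ _ t0 t1 z1 c1,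
      comb _ _ _ _ t0 t1 z5 c5, comb _ _ _ _ t0 t1 z6 c6, Or.inl (comb _ _ _ _ t0 t1 z2 c2)⟩
  · have c0 : 0 < side 0 ((δ / 2 : ℝ) * ω + 0 * ω ^ 4) := by
      have := side_0_coord (δ / 2) 0
      rw [Complex.ofReal_zero] at this
      rw [this]; nlinarith
    have c1 : 0 < side 1 ((δ / 2 : ℝ) * ω + 0 * ω ^ 4) := by
      have := side_1_coord (δ / 2) 0
      rw [Complex.ofReal_zero] at this
      rw [this]; nlinarith
    have c5 : 0 < side 5 ((δ / 2 : ℝ) * ω + 0 * ω ^ 4) := by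
      have := side_5_coord (δ / 2) 0
      rw [Complex.ofReal_zero] at this
      rw [this]; nlinarith
    have c6 : 0 < side 6 ((δ / 2 : ℝ) * ω + 0 * ω ^ 4) := by
      have := side_6_coord (δ / 2) 0
      rw [Complex.ofReal_zero] at this
      rw [this]; nlinarith
    have c3 : 0 < side 3 ((δ / 2 : ℝ) * ω + 0 * ω ^ 4) := by
      have := side_3_coord (δ / 2) 0
      rw [Complex.ofReal_zero] at this
      rw [this]; nlinarith
    exact key z _ fun t t0 t1 => ⟨comb _ _ _ _ t0 t1 z0 c0, comb _ _ _ _ t0 t1 z1 c1,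
      comb _ _ _ _ t0 t1 z5 c5, comb _ _ _ _ t0 t1 z6 c6,
      Or.inr (Or.inl (comb _ _ _ _ t0 t1 z3 c3))⟩
  · set β := δ * s₁ / (2 * s₃)
    have hβ : β * s₃ = δ * s₁ / 2 := by simp only [β]; field_simp
    have hβ0 : 0 < β := by positivity
    have hβ1 : β < δ := by
      have : β * s₃ < δ * s₃ := by rw [hβ]; nlinarith
      exact lt_of_mul_lt_mul_right this h3.le
    have c0 : 0 < side 0 ((-β : ℝ) * ω + δ * ω ^ 4) := by
      rw [side_0_coord]; nlinarith
    have c1 : 0 < side 1 ((-β : ℝ) * ω + δ * ω ^ 4) := by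
      rw [side_1_coord]; nlinarith [mul_pos hδ h2, mul_pos hβ0 h1]
    have c5 : 0 < side 5 ((-β : ℝ) * ω + δ * ω ^ 4) := by
      rw [side_5_coord, ← κ_add_one_mul_s₁]
      have h4 : δ + β * (κ + 1) < κ + 1 := by nlinarith
      nlinarith [mul_lt_mul_of_pos_right h4 h1]
    have c6 : 0 < side 6 ((-β : ℝ) * ω + δ * ω ^ 4) := by
      rw [side_6_coord]; nlinarith
    have c4 : 0 < side 4 ((-β : ℝ) * ω + δ * ω ^ 4) := by
      rw [side_4_coord]; nlinarith
    exact key z _ fun t t0 t1 => ⟨comb _ _ _ _ t0 t1 z0 c0, comb _ _ _ _ t0 t1 z1 c1,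
      comb _ _ _ _ t0 t1 z5 c5, comb _ _ _ _ t0 t1 z6 c6,
      Or.inr (Or.inr (comb _ _ _ _ t0 t1 z4 c4))⟩

theorem κ_mul_s₂ : κ * s₂ = s₁ - s₂ + s₃ := by
  have h : (κ : ℂ) * ω ^ 2 = ω - ω ^ 2 + ω ^ 3 := by linear_combination -ω * one_add_ω_sq
  have := congrArg Complex.im h
  rw [Complex.im_ofReal_mul] at this
  simpa [ω_im_1, ω_im_2, ω_im_3] using this

/-- The values of the functions `side` at the vertices. -/
noncomputable def sideVert : Fin 7 → Fin 7 → ℝ :=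
  ![![0, 0, s₂, -s₁ + s₂, s₂, s₂ + s₃, s₂],
  ![s₂, 0, 0, s₁, s₁ + s₃, s₁ + s₂ + s₃, s₂ + s₃],
  ![0, s₁, 0, 0, -s₂, -s₂ - s₃, -s₃],
  ![s₁ - s₂ + s₃, -s₂ + s₃, -s₂, 0, 0, -s₂, -s₂ + s₃],
  ![0, -s₃, -s₂ - s₃, -s₂, 0, 0, s₁],
  ![s₂, s₂ + s₃, s₁ + s₂ + s₃, s₁ + s₃, s₁, 0, 0],
  ![0, s₂, s₂ + s₃, s₂, -s₁ + s₂, s₂, 0]]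

/-- The rates of change of the functions `side` along the edges. -/
noncomputable def sideEdge : Fin 7 → Fin 7 → ℝ :=
  ![![0, s₂, -s₁, s₁, s₃, -s₃, -s₂],
  ![-s₂, 0, s₁, s₃, s₂, -s₁, -s₃],
  ![s₁, -s₁, 0, -s₂, -s₃, s₂, s₃],
  ![-s₁, -s₃, s₂, 0, -s₂, s₃, s₁],
  ![-s₃, -s₂, s₃, s₂, 0, s₁, -s₁],
  ![s₃, s₁, -s₂, -s₃, -s₁, 0, s₂],
  ![s₂, s₃, -s₃, -s₁, s₁, -s₂, 0]]

theorem ω_pow_18 : ω ^ 18 = ω ^ 4 := by linear_combination ω ^ 4 * ω_pow_fourteen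
theorem ω_pow_20 : ω ^ 20 = ω ^ 6 := by linear_combination ω ^ 6 * ω_pow_fourteen
theorem ω_pow_22 : ω ^ 22 = -ω := by linear_combination ω ^ 8 * ω_pow_fourteen + ω_pow_8
theorem ω_pow_24 : ω ^ 24 = -ω ^ 3 := by linear_combination ω ^ 10 * ω_pow_fourteen + ω_pow_10

theorem ω_pow_26 : ω ^ 26 = -ω ^ 5 := by linear_combination ω ^ 12 * ω_pow_fourteen + ω_pow_12

theorem ω_mul_self : ω * ω = ω ^ 2 := (sq ω).symm

theorem side_vert (i j : Fin 7) : side i (vert j) = sideVert i j := by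
  fin_cases i <;> fin_cases j <;>
  simp [side_0, side_1, side_2, side_3, side_4, side_5, side_6, vert, sideVert, mul_add, mul_sub,
    ← pow_add, ← pow_succ, ← pow_succ', ω_mul_self, ω_im_1, ω_im_2, ω_im_3, ω_im_4, ω_im_5, ω_im_6,
    ω_pow_seven, ω_pow_8, ω_pow_9, ω_pow_10, ω_pow_11, κ_mul_s₂] <;> ring

theorem side_edge (i j : Fin 7) : (ω ^ (14 - dir i) * ω ^ dir j).im = sideEdge i j := by
  rw [← pow_add]
  fin_cases i <;> fin_cases j <;>
  simp [dir, sideEdge, ω_im_1, ω_im_2, ω_im_3, ω_im_4, ω_im_5, ω_im_6,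
    ω_pow_8, ω_pow_10, ω_pow_12, ω_pow_fourteen,
    ω_pow_16, ω_pow_18, ω_pow_20, ω_pow_22, ω_pow_24, ω_pow_26]

/-- The point of the edge `j` at distance `τ` from its initial vertex. -/
noncomputable def edgePt (j : Fin 7) (τ : ℝ) : ℂ := vert j + τ * ω ^ dir j

theorem side_edgePt (i j : Fin 7) (τ : ℝ) :
    side i (edgePt j τ) = sideVert i j + τ * sideEdge i j := by
  rw [edgePt, side_add_mul, side_vert, side_edge]

theorem exists_side_neg (j : Fin 7) : ∃ c, side j c < 0 := by
  have h1 := s₁_pos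
  have h2 := s₂_pos
  have h3 := s₃_pos
  have hκ := κ_pos
  have hs := κ_add_one_mul_s₁
  fin_cases j
  · exact ⟨_, by rw [Fin.zero_eta, side_0_coord (-1) 0]; linarith⟩
  · exact ⟨_, by rw [Fin.mk_one, side_1_coord (κ + 2) 0]; linarith⟩
  · exact ⟨_, by rw [show (⟨2, by norm_num⟩ : Fin 7) = 2 from rfl, side_2_coord 0 1]; linarith⟩
  · exact ⟨_, by
      rw [show (⟨3, by norm_num⟩ : Fin 7) = 3 from rfl, side_3_coord (κ + 1) 0]; linarith⟩
  · exact ⟨_, by rw [show (⟨4, by norm_num⟩ : Fin 7) = 4 from rfl, side_4_coord 1 0]; linarith⟩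
  · exact ⟨_, by
      rw [show (⟨5, by norm_num⟩ : Fin 7) = 5 from rfl, side_5_coord 0 (κ + 2)]; linarith⟩
  · exact ⟨_, by rw [show (⟨6, by norm_num⟩ : Fin 7) = 6 from rfl, side_6_coord (-1) 0]; linarith⟩

/-- A small move from `z` towards a point with a negative side function would leave the tile if that
function were not positive at `z`. The three concave sides are alternatives, so they need one target
beyond all of them: the point with both coordinates `κ`. -/
theorem interior_P : interior P = Pint := by
  refine subset_antisymm (fun z hz => ?_) Pint_subset_interior
  have hnot : ∀ c : ℂ, ¬ ∀ t : ℝ, 0 < t → t < 1 → z + t * (c - z) ∉ P := by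
    intro c h
    have lim : Tendsto (fun t : ℝ => z + t * (c - z)) (𝓝[>] 0) (𝓝 z) := by
      have : Continuous (fun t : ℝ => z + t * (c - z)) := by fun_prop
      have := this.tendsto 0
      simp only [Complex.ofReal_zero, zero_mul, add_zero] at this
      exact this.mono_left nhdsWithin_le_nhds
    have h1 := lim.eventually (mem_interior_iff_mem_nhds.1 hz)
    have h2 : Set.Ioo (0 : ℝ) 1 ∈ 𝓝[>] (0 : ℝ) := Ioo_mem_nhdsGT one_pos
    obtain ⟨t, ht, ht'⟩ := (h1.and h2).exists
    exact h t ht'.1 ht'.2 ht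
  have comb : ∀ (j : Fin 7) (c : ℂ) (t : ℝ), 0 < t → t < 1 → side j z ≤ 0 → side j c < 0 →
      side j (z + t * (c - z)) < 0 := by
    intro j c t h0 h1 hz hc
    rw [side_lineMap]
    nlinarith [mul_nonneg (sub_pos.2 h1).le (neg_nonneg.2 hz), mul_pos h0 (neg_pos.2 hc)]
  have pos : ∀ j, (∀ z, z ∈ P → 0 ≤ side j z) → 0 < side j z := by
    intro j hj
    by_contra! hle
    obtain ⟨c, hc⟩ := exists_side_neg j
    exact hnot c fun t t0 t1 ht => absurd (hj _ ht) (not_le.2 (comb j c t t0 t1 hle hc))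
  refine ⟨pos 0 fun z h => h.1, pos 1 fun z h => h.2.1, pos 5 fun z h => h.2.2.1,
    pos 6 fun z h => h.2.2.2.1, ?_⟩
  by_contra! hle
  have h2 := s₂_pos
  have h3 := s₃_pos
  have hκ := κ_pos
  have c2 : side 2 (κ * ω + κ * ω ^ 4) < 0 := by rw [side_2_coord]; nlinarith
  have c3 : side 3 (κ * ω + κ * ω ^ 4) < 0 := by rw [side_3_coord]; nlinarith
  have c4 : side 4 (κ * ω + κ * ω ^ 4) < 0 := by rw [side_4_coord]; nlinarith
  refine hnot (κ * ω + κ * ω ^ 4) fun t t0 t1 ht => ?_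
  have k2 := comb 2 _ t t0 t1 hle.1 c2
  have k3 := comb 3 _ t t0 t1 hle.2.1 c3
  have k4 := comb 4 _ t t0 t1 hle.2.2 c4
  rcases ht.2.2.2.2 with h | h | h <;> linarith

theorem frontier_P : frontier P = P \ Pint := by
  rw [frontier, isClosed_P.closure_eq, interior_P]

theorem edgePt_mem_frontier (j : Fin 7) {τ : ℝ} (h0 : 0 ≤ τ) (h1 : τ ≤ 1) :
    edgePt j τ ∈ frontier P := by
  have p1 := s₁_pos
  have p12 := s₁_lt_s₂
  have p23 := s₂_lt_s₃
  have p2 := s₂_pos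
  have p3 := s₃_pos
  -- The side functions are affine in τ, so their signs follow from products of τ and 1 - τ with
  -- `s₁`, `s₂ - s₁` and `s₃ - s₂`.
  have q1 := mul_nonneg h0 p1.le
  have q2 := mul_nonneg h0 (sub_pos.2 p12).le
  have q3 := mul_nonneg h0 (sub_pos.2 p23).le
  have r0 := sub_nonneg.2 h1
  have r1 := mul_nonneg r0 p1.le
  have r2 := mul_nonneg r0 (sub_pos.2 p12).le
  have r3 := mul_nonneg r0 (sub_pos.2 p23).le
  rw [frontier_P]
  constructor
  · simp only [P, Set.mem_ofPred_eq, side_edgePt]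
    fin_cases j <;> simp only [sideVert, sideEdge, Matrix.cons_val, Fin.zero_eta, Fin.mk_one,
      Fin.reduceFinMk]
    · refine ⟨?_, ?_, ?_, ?_, Or.inl ?_⟩ <;> nlinarith
    · refine ⟨?_, ?_, ?_, ?_, Or.inl ?_⟩ <;> nlinarith
    · refine ⟨?_, ?_, ?_, ?_, Or.inl ?_⟩ <;> nlinarith
    · refine ⟨?_, ?_, ?_, ?_, Or.inr (Or.inl ?_)⟩ <;> nlinarith
    · refine ⟨?_, ?_, ?_, ?_, Or.inr (Or.inr ?_)⟩ <;> nlinarith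
    · refine ⟨?_, ?_, ?_, ?_, Or.inr (Or.inr ?_)⟩ <;> nlinarith
    · refine ⟨?_, ?_, ?_, ?_, Or.inr (Or.inr ?_)⟩ <;> nlinarith
  · simp only [Pint, Set.mem_ofPred_eq, side_edgePt]
    fin_cases j <;> simp only [sideVert, sideEdge, Matrix.cons_val, Fin.zero_eta, Fin.mk_one,
      Fin.reduceFinMk]
    · rintro ⟨h, -⟩; nlinarith
    · rintro ⟨-, h, -⟩; nlinarith
    · rintro ⟨-, -, -, -, h | h | h⟩ <;> nlinarith
    · rintro ⟨-, -, -, -, h | h | h⟩ <;> nlinarith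
    · rintro ⟨-, -, -, -, h | h | h⟩ <;> nlinarith
    · rintro ⟨-, -, h, -⟩; nlinarith
    · rintro ⟨-, -, -, h, -⟩; nlinarith

theorem exists_eq_edgePt {j : Fin 7} {z : ℂ} (h : side j z = 0) : ∃ τ : ℝ, z = edgePt j τ := by
  refine ⟨(ω ^ (14 - dir j) * (z - vert j)).re, ?_⟩
  have h1 : ω ^ (14 - dir j) * (z - vert j) = ((ω ^ (14 - dir j) * (z - vert j)).re : ℂ) :=
    Complex.ext rfl (by rw [Complex.ofReal_im]; exact h)
  rw [edgePt, ← h1]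
  linear_combination -(z - vert j) * ω_pow_dir_mul j

/-- Some side function vanishes at `z`; a parameter outside [0, 1] on its line would violate the
inequality of another side. -/
theorem mem_edge_of_mem_frontier {z : ℂ} (hz : z ∈ frontier P) :
    ∃ (j : Fin 7) (τ : ℝ), 0 ≤ τ ∧ τ ≤ 1 ∧ z = edgePt j τ := by
  have p1 := s₁_pos
  have p12 := s₁_lt_s₂
  have p23 := s₂_lt_s₃
  have p2 := s₂_pos
  have p3 := s₃_pos
  rw [frontier_P] at hz
  obtain ⟨⟨h0, h1, h5, h6, h⟩, hz⟩ := hz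
  have bound : ∀ (j : Fin 7), side j z = 0 →
      (∀ τ : ℝ, z = edgePt j τ → τ < 0 → False) → (∀ τ : ℝ, z = edgePt j τ → 1 < τ → False) →
      ∃ (j : Fin 7) (τ : ℝ), 0 ≤ τ ∧ τ ≤ 1 ∧ z = edgePt j τ := by
    intro j hj k0 k1
    obtain ⟨τ, hτ⟩ := exists_eq_edgePt hj
    exact ⟨j, τ, not_lt.1 (k0 τ hτ), not_lt.1 (k1 τ hτ), hτ⟩
  rcases h0.eq_or_lt' with e | h0'
  · refine bound 0 e (fun τ hτ ht => ?_) (fun τ hτ ht => ?_) <;> subst hτ <;>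
      simp only [side_edgePt, sideVert, sideEdge, Matrix.cons_val] at *
    · nlinarith
    · nlinarith
  rcases h1.eq_or_lt' with e | h1'
  · refine bound 1 e (fun τ hτ ht => ?_) (fun τ hτ ht => ?_) <;> subst hτ <;>
      simp only [side_edgePt, sideVert, sideEdge, Matrix.cons_val] at *
    · nlinarith
    · rcases h with h | h | h <;> nlinarith
  rcases h5.eq_or_lt' with e | h5'
  · refine bound 5 e (fun τ hτ ht => ?_) (fun τ hτ ht => ?_) <;> subst hτ <;>
      simp only [side_edgePt, sideVert, sideEdge, Matrix.cons_val] at *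
    · rcases h with h | h | h <;> nlinarith
    · nlinarith
  rcases h6.eq_or_lt' with e | h6'
  · refine bound 6 e (fun τ hτ ht => ?_) (fun τ hτ ht => ?_) <;> subst hτ <;>
      simp only [side_edgePt, sideVert, sideEdge, Matrix.cons_val] at *
    · nlinarith
    · nlinarith
  have hn : side 2 z ≤ 0 ∧ side 3 z ≤ 0 ∧ side 4 z ≤ 0 := by
    by_contra hc
    refine hz ⟨h0', h1', h5', h6', ?_⟩
    by_contra! hc'
    exact hc hc'
  obtain ⟨n2, n3, n4⟩ := hn
  rcases h with h | h | h
  · refine bound 2 (le_antisymm n2 h) (fun τ hτ ht => ?_) (fun τ hτ ht => ?_) <;> subst hτ <;>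
      simp only [side_edgePt, sideVert, sideEdge, Matrix.cons_val] at *
    · nlinarith
    · nlinarith
  · refine bound 3 (le_antisymm n3 h) (fun τ hτ ht => ?_) (fun τ hτ ht => ?_) <;> subst hτ <;>
      simp only [side_edgePt, sideVert, sideEdge, Matrix.cons_val] at *
    · nlinarith
    · nlinarith
  · refine bound 4 (le_antisymm n4 h) (fun τ hτ ht => ?_) (fun τ hτ ht => ?_) <;> subst hτ <;>
      simp only [side_edgePt, sideVert, sideEdge, Matrix.cons_val] at *
    · nlinarith
    · nlinarith

/-- The inner angle at a point of the edge `j`, as a multiple of `π / 7`. -/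
noncomputable def angAt (j : Fin 7) (τ : ℝ) : ℕ := if τ = 0 then ang j else 7

theorem eventually_side_pos_of_pos {j : Fin 7} {q : ℂ} (d : ℂ) (h : 0 < side j q) :
    ∀ᶠ r : ℝ in 𝓝[>] 0, 0 < side j (q + r * d) := by
  have : Continuous (fun r : ℝ => side j (q + r * d)) := (continuous_side j).comp (by fun_prop)
  have := this.tendsto 0
  simp only [Complex.ofReal_zero, zero_mul, add_zero] at this
  exact (this.mono_left nhdsWithin_le_nhds).eventually (lt_mem_nhds h)

theorem eventually_side_pos_of_im_pos {j : Fin 7} {q d : ℂ} (h : 0 ≤ side j q)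
    (hd : 0 < (ω ^ (14 - dir j) * d).im) :
    ∀ᶠ r : ℝ in 𝓝[>] 0, 0 < side j (q + r * d) := by
  filter_upwards [self_mem_nhdsWithin] with r hr
  rw [side_add_mul]
  have := mul_pos (Set.mem_Ioi.1 hr) hd
  linarith

/-- Close to a boundary point, the rays that enter the inner angle consist of interior points. -/
theorem eventually_mem_interior (j : Fin 7) {τ : ℝ} (h0 : 0 ≤ τ) (h1 : τ < 1) {k : ℕ} (hk : 0 < k)
    (hk' : k < angAt j τ) :
    ∀ᶠ r : ℝ in 𝓝[>] 0, edgePt j τ + r * ω ^ (dir j + k) ∈ interior P := by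
  have p1 := s₁_pos
  have p12 := s₁_lt_s₂
  have p23 := s₂_lt_s₃
  have p2 := s₂_pos
  have p3 := s₃_pos
  have r0 := sub_pos.2 h1
  have r1 := mul_pos r0 p1
  have r2 := mul_pos r0 (sub_pos.2 p12)
  have r3 := mul_pos r0 (sub_pos.2 p23)
  set d := ω ^ (dir j + k) with hd
  have ev : ∀ i, 0 < side i (edgePt j τ) ∨ (0 ≤ side i (edgePt j τ) ∧
      0 < (ω ^ (14 - dir i) * d).im) → ∀ᶠ r : ℝ in 𝓝[>] 0, 0 < side i (edgePt j τ + r * d) := by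
    rintro i (h | ⟨h, h'⟩)
    · exact eventually_side_pos_of_pos d h
    · exact eventually_side_pos_of_im_pos h h'
  have key : (∀ᶠ r : ℝ in 𝓝[>] 0, 0 < side 0 (edgePt j τ + r * d)) →
      (∀ᶠ r : ℝ in 𝓝[>] 0, 0 < side 1 (edgePt j τ + r * d)) →
      (∀ᶠ r : ℝ in 𝓝[>] 0, 0 < side 5 (edgePt j τ + r * d)) →
      (∀ᶠ r : ℝ in 𝓝[>] 0, 0 < side 6 (edgePt j τ + r * d)) →
      (∃ i : Fin 7, (i = 2 ∨ i = 3 ∨ i = 4) ∧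
        ∀ᶠ r : ℝ in 𝓝[>] 0, 0 < side i (edgePt j τ + r * d)) →
      ∀ᶠ r : ℝ in 𝓝[>] 0, edgePt j τ + r * d ∈ interior P := by
    rintro e0 e1 e5 e6 ⟨i, hi, ei⟩
    filter_upwards [e0, e1, e5, e6, ei] with r h0 h1 h5 h6 hi'
    rw [interior_P]
    refine ⟨h0, h1, h5, h6, ?_⟩
    rcases hi with rfl | rfl | rfl <;> tauto
  have own : k < 7 → 0 < (ω ^ (14 - dir j) * d).im := by
    intro h7
    rw [hd, pow_add, ← mul_assoc, ω_pow_dir_mul, one_mul]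
    exact ω_im_pos hk h7
  rcases h0.eq_or_lt' with rfl | hτ
  · rw [angAt, if_pos rfl] at hk'
    simp only [side_edgePt, zero_mul, add_zero] at ev
    have prev : ∀ (i : Fin 7) (n : ℕ), (14 - dir i + dir j + k = n + 14 ∨ 14 - dir i + dir j + k = n) → 0 < n → n < 7 →
        0 < (ω ^ (14 - dir i) * d).im := by
      intro i n hn n0 n7
      rw [hd, ← pow_add, ← add_assoc]
      rcases hn with hn | hn <;> rw [hn]
      · rw [pow_add, ω_pow_fourteen, mul_one]
        exact ω_im_pos n0 n7
      · exact ω_im_pos n0 n7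
    fin_cases j <;>
      simp only [sideVert, Matrix.cons_val, Fin.zero_eta, Fin.mk_one, Fin.reduceFinMk, ang,
        Fin.isValue] at *
    · exact key (ev 0 (.inr ⟨le_rfl, own (by omega)⟩)) (ev 1 (.inl p2)) (ev 5 (.inl p2))
        (ev 6 (.inr ⟨le_rfl, prev 6 (k + 2) (by simp [dir]; omega) (by omega) (by omega)⟩))
        ⟨3, by simp, ev 3 (.inl (by simp; linarith))⟩
    · exact key (ev 0 (.inr ⟨le_rfl, prev 0 (k + 2) (by simp [dir]; omega) (by omega) (by omega)⟩))
        (ev 1 (.inr ⟨le_rfl, own (by omega)⟩)) (ev 5 (.inl (by simp; linarith))) (ev 6 (.inl p2))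
        ⟨2, by simp, ev 2 (.inl p1)⟩
    · omega
    · refine key (ev 0 (.inl (by simp; linarith))) (ev 1 (.inl p1)) (ev 5 (.inl (by simp; linarith)))
        (ev 6 (.inl p2)) ?_
      -- At a reflex vertex either adjacent side suffices: the outgoing edge serves for k < 7, the
      -- incoming one for k = 7, 8.
      by_cases h7 : k < 7
      · exact ⟨3, by simp, ev 3 (.inr ⟨le_rfl, own h7⟩)⟩
      · exact ⟨2, by simp, ev 2 (.inr ⟨le_rfl,
          prev 2 (k - 2) (by simp [dir]; omega) (by omega) (by omega)⟩)⟩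
    · refine key (ev 0 (.inl p2)) (ev 1 (.inl (by simp; linarith))) (ev 5 (.inl p1))
        (ev 6 (.inl (by simp; linarith))) ?_
      by_cases h7 : k < 7
      · exact ⟨4, by simp, ev 4 (.inr ⟨le_rfl, own h7⟩)⟩
      · exact ⟨3, by simp, ev 3 (.inr ⟨le_rfl,
          prev 3 (k - 2) (by simp [dir]; omega) (by omega) (by omega)⟩)⟩
    · omega
    · exact key (ev 0 (.inl p2)) (ev 1 (.inl (by simp; linarith)))
        (ev 5 (.inr ⟨le_rfl, prev 5 (k + 2) (by simp [dir]; omega) (by omega) (by omega)⟩))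
        (ev 6 (.inr ⟨le_rfl, own (by omega)⟩)) ⟨4, by simp, ev 4 (.inl p1)⟩
  · rw [angAt, if_neg hτ.ne'] at hk'
    have own := own hk'
    have q1 := mul_pos hτ p1
    have q2 := mul_pos hτ (sub_pos.2 p12)
    have q3 := mul_pos hτ (sub_pos.2 p23)
    have ev1 := fun i h => ev i (.inl h)
    have ev2 := fun i (h : 0 ≤ side i (edgePt j τ) ∧ _) => ev i (.inr h)
    simp only [side_edgePt] at ev1 ev2
    fin_cases j <;>
      simp only [sideVert, sideEdge, Fin.zero_eta, Fin.mk_one,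
        Fin.reduceFinMk] at *
    · exact key (ev2 0 ⟨by simp, own⟩) (ev1 1 (by simp; nlinarith)) (ev1 5 (by simp; nlinarith))
        (ev1 6 (by simp; nlinarith)) ⟨2, by simp, ev1 2 (by simp; nlinarith)⟩
    · exact key (ev1 0 (by simp; nlinarith)) (ev2 1 ⟨by simp, own⟩) (ev1 5 (by simp; nlinarith))
        (ev1 6 (by simp; nlinarith)) ⟨2, by simp, ev1 2 (by simp; nlinarith)⟩
    · exact key (ev1 0 (by simp; nlinarith)) (ev1 1 (by simp; nlinarith))
        (ev1 5 (by simp; nlinarith)) (ev1 6 (by simp; nlinarith))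
        ⟨2, by simp, ev2 2 ⟨by simp, own⟩⟩
    · exact key (ev1 0 (by simp; nlinarith)) (ev1 1 (by simp; nlinarith))
        (ev1 5 (by simp; nlinarith)) (ev1 6 (by simp; nlinarith))
        ⟨3, by simp, ev2 3 ⟨by simp, own⟩⟩
    · exact key (ev1 0 (by simp; nlinarith)) (ev1 1 (by simp; nlinarith))
        (ev1 5 (by simp; nlinarith)) (ev1 6 (by simp; nlinarith))
        ⟨4, by simp, ev2 4 ⟨by simp, own⟩⟩
    · exact key (ev1 0 (by simp; nlinarith)) (ev1 1 (by simp; nlinarith)) (ev2 5 ⟨by simp, own⟩)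
        (ev1 6 (by simp; nlinarith)) ⟨4, by simp, ev1 4 (by simp; nlinarith)⟩
    · exact key (ev1 0 (by simp; nlinarith)) (ev1 1 (by simp; nlinarith))
        (ev1 5 (by simp; nlinarith)) (ev2 6 ⟨by simp, own⟩)
        ⟨4, by simp, ev1 4 (by simp; nlinarith)⟩

/-! ### The tile `T` is similar to the normalized tile -/

/-- The copy of the normalized tile with base vertex `p` and first edge `w`. -/
def tile (p w : ℂ) : Set ℂ := (fun z => p + w * z) '' P

theorem κ_mul_s₃ : κ * s₃ = s₂ := by
  have h : (κ : ℂ) * ω ^ 3 = ω ^ 2 + ω ^ 4 - ω ^ 3 := by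
    linear_combination -ω ^ 2 * one_add_ω_sq
  have := congrArg Complex.im h
  rw [Complex.im_ofReal_mul] at this
  simpa [ω_im_2, ω_im_3, ω_im_4] using this

theorem one_eq_coord : (1 : ℂ) = (1 : ℝ) * ω + (-(s₁ / s₃) : ℝ) * ω ^ 4 := by
  obtain ⟨a, b, h⟩ := exists_coord 1
  have h1 := congrArg (side 4) h
  have h0 := congrArg (side 0) h
  rw [side_4_coord, side_4] at h1
  rw [side_0_coord, side_0] at h0
  have h3 := s₃_pos
  have ha : a = 1 := by
    simp only [mul_one, ω_im_3] at h1
    exact mul_right_cancel₀ h3.ne' (by linarith)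
  have hb : b = -(s₁ / s₃) := by
    simp only [Complex.one_im, ha] at h0
    field_simp
    linarith
  rw [← ha, ← hb, ← h]

theorem ω_pow_five_eq_coord : ω ^ 5 = (-(s₁ / s₃) : ℝ) * ω + (1 : ℝ) * ω ^ 4 := by
  have h := congrArg conj one_eq_coord
  simp only [map_one, map_add, map_mul, map_pow, conj_ofReal, conj_ω] at h
  have h4 : (ω ^ 13) ^ 4 = ω ^ 10 := by
    rw [← pow_mul]
    linear_combination (ω ^ 38 + ω ^ 24 + ω ^ 10) * ω_pow_fourteen
  rw [h4] at h
  linear_combination ω ^ 5 * h + (1 : ℝ) * ω ^ 4 * ω_pow_fourteen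
    + (-(s₁ / s₃) : ℝ) * ω * ω_pow_fourteen

/-- The similarity that maps the normalized tile to `T`. -/
noncomputable def toT (z : ℂ) : ℂ := 1 + (ζ - 1) * z

theorem ζ_sub_one_ne_zero : ζ - 1 ≠ 0 := by
  intro h
  rw [← ω_sq] at h
  have := congrArg Complex.im h
  simp [ω_im_2] at this
  exact s₂_pos.ne' this

theorem toT_surj (y : ℂ) : ∃ z, toT z = y :=
  ⟨(y - 1) / (ζ - 1), by unfold toT; field_simp [ζ_sub_one_ne_zero]; ring⟩

theorem toT_inj {z w : ℂ} (h : toT z = toT w) : z = w := by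
  unfold toT at h
  exact mul_left_cancel₀ ζ_sub_one_ne_zero (add_left_cancel h)

theorem toT_lineMap (z w : ℂ) (t : ℝ) :
    toT (z + t * (w - z)) = toT z + t * (toT w - toT z) := by
  unfold toT; ring

/-! ### The heptagon in normalized coordinates. -/

theorem continuous_toT : Continuous toT := by unfold toT; fun_prop

theorem pow_mem_heptagon (k : Fin 7) : ζ ^ (k : ℕ) ∈ heptagon :=
  subset_convexHull _ _ ⟨k, rfl⟩

theorem convex_heptagon : Convex ℝ heptagon := convex_convexHull _ _

theorem lineMap_mem_heptagon {x y : ℂ} (hx : x ∈ heptagon) (hy : y ∈ heptagon) {t : ℝ}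
    (h0 : 0 ≤ t) (h1 : t ≤ 1) : x + t * (y - x) ∈ heptagon := by
  have := convex_heptagon hx hy (sub_nonneg.2 h1) h0 (by ring)
  convert this using 1
  simp only [Complex.real_smul]
  push_cast; ring

theorem triangle_mem_heptagon {x y z : ℂ} (hx : toT x ∈ heptagon) (hy : toT y ∈ heptagon)
    (hz : toT z ∈ heptagon) {a b c : ℝ} (ha : 0 ≤ a) (hb : 0 ≤ b) (hc : 0 ≤ c)
    (h : a + b + c = 1) : toT (a * x + b * y + c * z) ∈ heptagon := by
  have := convex_heptagon.sum_mem (t := Finset.univ) (w := ![a, b, c])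
    (z := ![toT x, toT y, toT z])
    (by intro i _; fin_cases i <;> simpa)
    (by simp [Fin.sum_univ_three, h]) (by intro i _; fin_cases i <;> simpa)
  simp only [Fin.sum_univ_three, Matrix.cons_val, Complex.real_smul] at this
  convert this using 1
  have h' : (a : ℂ) + b + c = 1 := by exact_mod_cast h
  unfold toT
  linear_combination -h'

theorem toT_mem_0 : toT 0 ∈ heptagon := by simpa [toT] using pow_mem_heptagon 0

theorem toT_mem_1 : toT 1 ∈ heptagon := by simpa [toT] using pow_mem_heptagon 1

theorem toT_mem_2 : toT ((κ + 1 : ℝ) * ω) ∈ heptagon := by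
  have := pow_mem_heptagon 2
  convert this using 1
  change _ = ζ ^ 2
  rw [toT, Complex.ofReal_add, Complex.ofReal_one, ← one_add_ω_sq, ω_sq]
  ring

theorem toT_mem_3 : toT ((κ + 1 : ℝ) * ω + ω ^ 4) ∈ heptagon := by
  have := pow_mem_heptagon 3
  convert this using 1
  change _ = ζ ^ 3
  rw [toT, Complex.ofReal_add, Complex.ofReal_one, ← one_add_ω_sq,
    show ω ^ 4 = (ω ^ 2) ^ 2 by ring, ω_sq]
  ring

theorem mul_ω_pow_four : ((κ : ℂ) + 1) * ω ^ 4 = ω ^ 5 + ω ^ 3 := by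
  linear_combination -ω ^ 3 * one_add_ω_sq

theorem toT_mem_4 : toT (ω + (κ + 1 : ℝ) * ω ^ 4) ∈ heptagon := by
  have := pow_mem_heptagon 4
  convert this using 1
  rw [toT, Complex.ofReal_add, Complex.ofReal_one, mul_ω_pow_four, ← ω_sq]
  simp only [Fin.isValue, Fin.coe_ofNat_eq_mod]; norm_num
  linear_combination (ω ^ 3 - ω) * ω_pow_seven - (ω ^ 2 - 1) * (ω^2 + ω+1) * cyclotomic

theorem toT_mem_5 : toT ((κ + 1 : ℝ) * ω ^ 4) ∈ heptagon := by
  have := pow_mem_heptagon 5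
  convert this using 1
  rw [toT, Complex.ofReal_add, Complex.ofReal_one, mul_ω_pow_four, ← ω_sq]
  simp only [Fin.isValue, Fin.coe_ofNat_eq_mod]; norm_num
  linear_combination (1 - ω ^ 3) * ω_pow_seven

theorem toT_mem_6 : toT (ω ^ 5) ∈ heptagon := by
  have := pow_mem_heptagon 6
  convert this using 1
  rw [toT, ← ω_sq]
  simp only [Fin.isValue, Fin.coe_ofNat_eq_mod]; norm_num
  linear_combination (1 - ω ^ 5) * ω_pow_seven

/-- The pentagon cut off from the heptagon by two diagonals. -/
theorem toT_mem_heptagon_of_coord {a b : ℝ} (ha : 0 ≤ a) (hb : 0 ≤ b) (ha' : a ≤ κ + 1)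
    (hb' : b ≤ κ + 1) (hab : a + b ≤ κ + 2) : toT (a * ω + b * ω ^ 4) ∈ heptagon := by
  have hκ := κ_pos
  rcases le_total (a + b) (κ + 1) with h | h
  · have := triangle_mem_heptagon toT_mem_0 toT_mem_2 toT_mem_5
      (a := 1 - a / (κ + 1) - b / (κ + 1)) (b := a / (κ + 1)) (c := b / (κ + 1))
      (by rw [sub_sub, ← add_div, sub_nonneg, div_le_one (by linarith)]; exact h)
      (by positivity) (by positivity) (by ring)
    convert this using 2
    have : (κ : ℂ) + 1 ≠ 0 := by exact_mod_cast (by linarith : κ + 1 ≠ 0)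
    push_cast
    field_simp
    ring
  -- Between the chord a + b = κ + 1 and its parallel edge a + b = κ + 2: `t` is the height above
  -- the chord, `l` the position on the parallel segment at that height.
  · obtain ⟨t, ht⟩ : ∃ t, t = a + b - (κ + 1) := ⟨_, rfl⟩
    have hd : 0 < κ + 1 - t := by linarith
    obtain ⟨l, hl⟩ : ∃ l, l = (b - t) / (κ + 1 - t) := ⟨_, rfl⟩
    have e1 := lineMap_mem_heptagon toT_mem_2 toT_mem_3 (t := t) (by linarith) (by linarith)
    have e2 := lineMap_mem_heptagon toT_mem_5 toT_mem_4 (t := t) (by linarith) (by linarith)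
    rw [← toT_lineMap] at e1 e2
    have e3 := lineMap_mem_heptagon e1 e2 (t := l)
      (by rw [hl]; exact div_nonneg (by linarith) hd.le)
      (by rw [hl, div_le_one hd]; linarith)
    rw [← toT_lineMap] at e3
    convert e3 using 2
    have hl' : (l : ℂ) * (κ + 1 - t) = b - t := by
      have : l * (κ + 1 - t) = b - t := by rw [hl]; field_simp
      exact_mod_cast this
    have ht' : (t : ℂ) = a + b - (κ + 1) := by exact_mod_cast ht
    push_cast
    linear_combination (ω - ω ^ 4) * hl' - ω * ht'

/-- Each bound defines a half-plane, so it is enough to test the seven vertices. The last three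
bounds mean b ≤ κ + 1, a + b ≤ κ + 2 and a ≤ κ + 1; they belong to the edges that the tile replaces.
-/
theorem heptagon_subset {z : ℂ} (hz : toT z ∈ heptagon) :
    (0 ≤ side 0 z ∧ 0 ≤ side 1 z ∧ 0 ≤ side 5 z ∧ 0 ≤ side 6 z) ∧
    -((κ + 1) * s₃) ≤ side 2 z ∧ -(2 * s₂) ≤ side 3 z ∧ -((κ + 1) * s₃) ≤ side 4 z := by
  have h1 := s₁_pos
  have h2 := s₂_pos
  have h3 := s₃_pos
  have h12 := s₁_lt_s₂
  have h23 := s₂_lt_s₃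
  have hκ := κ_pos
  have e1 := κ_add_one_mul_s₁
  have e2 := κ_mul_s₂
  have e3 := κ_mul_s₃
  let lb : Fin 7 → ℝ := ![0, 0, -((κ + 1) * s₃), -(2 * s₂), -((κ + 1) * s₃), 0, 0]
  let N : Set ℂ := {y | ∀ z, toT z = y → ∀ j, lb j ≤ side j z}
  have hN : Convex ℝ N := by
    intro x hx y hy a b ha hb hab z hz j
    obtain ⟨x', rfl⟩ := toT_surj x
    obtain ⟨y', rfl⟩ := toT_surj y
    have : z = x' + b * (y' - x') := by
      apply toT_inj
      rw [hz, toT_lineMap]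
      have : (a : ℂ) = 1 - b := by rw [eq_sub_iff_add_eq]; exact_mod_cast hab
      simp only [Complex.real_smul, this]; ring
    rw [this, side_lineMap]
    have k1 := mul_le_mul_of_nonneg_left (hx x' rfl j) ha
    have k2 := mul_le_mul_of_nonneg_left (hy y' rfl j) hb
    have k3 : a = 1 - b := by linarith
    rw [k3] at k1
    linarith
  have mem : ∀ z, (∀ j, lb j ≤ side j z) → toT z ∈ N := by
    intro z h w hw
    rw [toT_inj hw]; exact h
  have c0 : toT 0 ∈ N := mem _ fun j => by
    have := fun i => side_vert i 0
    simp only [vert, Matrix.cons_val_zero] at this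
    rw [this]
    fin_cases j <;> simp [lb, sideVert] <;> nlinarith
  have c1 : toT 1 ∈ N := mem _ fun j => by
    have := fun i => side_vert i 1
    simp only [vert, Matrix.cons_val] at this
    rw [this]
    fin_cases j <;> simp [lb, sideVert] <;> nlinarith
  have c6 : toT (ω ^ 5) ∈ N := mem _ fun j => by
    have := fun i => side_vert i 6
    simp only [vert, Matrix.cons_val] at this
    rw [this]
    fin_cases j <;> simp [lb, sideVert] <;> nlinarith
  have cab : ∀ a b : ℝ, 0 ≤ a → 0 ≤ b → a ≤ κ + 1 → b ≤ κ + 1 → a + b ≤ κ + 2 →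
      toT (a * ω + b * ω ^ 4) ∈ N := fun a b ha hb ha' hb' hab => mem _ fun j => by
    have k1 := mul_nonneg ha h1.le
    have k2 := mul_nonneg ha h2.le
    have k3 := mul_nonneg ha h3.le
    have l1 := mul_nonneg hb h1.le
    have l2 := mul_nonneg hb h2.le
    have l3 := mul_nonneg hb h3.le
    have m1 := mul_le_mul_of_nonneg_right ha' h1.le
    have m3 := mul_le_mul_of_nonneg_right ha' h3.le
    have n1 := mul_le_mul_of_nonneg_right hb' h1.le
    have n3 := mul_le_mul_of_nonneg_right hb' h3.le
    have o2 := mul_le_mul_of_nonneg_right hab h2.le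
    fin_cases j
    · exact (side_0_coord a b).symm ▸ (by simp only [lb, Fin.zero_eta, Matrix.cons_val]; linarith)
    · exact (side_1_coord a b).symm ▸ (by simp only [lb, Fin.mk_one, Matrix.cons_val]; linarith)
    · exact (side_2_coord a b).symm ▸ (by
        simp only [lb, Fin.reduceFinMk, Matrix.cons_val]; linarith)
    · exact (side_3_coord a b).symm ▸ (by
        simp only [lb, Fin.reduceFinMk, Matrix.cons_val]; linarith)
    · exact (side_4_coord a b).symm ▸ (by
        simp only [lb, Fin.reduceFinMk, Matrix.cons_val]; linarith)
    · exact (side_5_coord a b).symm ▸ (by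
        simp only [lb, Fin.reduceFinMk, Matrix.cons_val]; linarith)
    · exact (side_6_coord a b).symm ▸ (by
        simp only [lb, Fin.reduceFinMk, Matrix.cons_val]; linarith)
  have hsub : heptagon ⊆ N := by
    refine convexHull_min ?_ hN
    rintro _ ⟨k, rfl⟩
    fin_cases k
    · simpa [toT] using c0
    · simpa [toT] using c1
    · have := cab (κ + 1) 0 (by linarith) le_rfl le_rfl (by linarith) (by linarith)
      convert this using 1
      change ζ ^ 2 = _
      rw [toT, Complex.ofReal_add, Complex.ofReal_one, ← one_add_ω_sq, ω_sq]
      simp only [Complex.ofReal_zero]; ring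
    · have := cab (κ + 1) 1 (by linarith) (by linarith) le_rfl (by linarith) (by linarith)
      convert this using 1
      change ζ ^ 3 = _
      rw [toT, Complex.ofReal_add, Complex.ofReal_one, ← one_add_ω_sq,
        show ω ^ 4 = (ω ^ 2) ^ 2 by ring, ω_sq]
      ring
    · have := cab 1 (κ + 1) (by linarith) (by linarith) (by linarith) le_rfl (by linarith)
      convert this using 1
      rw [toT, Complex.ofReal_add, Complex.ofReal_one, mul_ω_pow_four, ← ω_sq]
      change (ω ^ 2) ^ 4 = _
      linear_combination (ω - ω ^ 3) * ω_pow_seven + (ω ^ 2 - 1) * (ω^2 + ω+1) * cyclotomic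
    · have := cab 0 (κ + 1) le_rfl (by linarith) (by linarith) le_rfl (by linarith)
      convert this using 1
      rw [toT, Complex.ofReal_add, Complex.ofReal_one, mul_ω_pow_four, ← ω_sq,
        Complex.ofReal_zero]
      change (ω ^ 2) ^ 5 = _
      linear_combination -(1 - ω ^ 3) * ω_pow_seven
    · convert c6 using 1
      rw [toT, ← ω_sq]
      change (ω ^ 2) ^ 6 = _
      linear_combination -(1 - ω ^ 5) * ω_pow_seven
  have := hsub hz z rfl
  exact ⟨⟨this 0, this 1, this 5, this 6⟩, this 2, this 3, this 4⟩

theorem chordReflection_eq (z : ℂ) : chordReflection z = ω ^ 4 + ω ^ 10 - conj z := by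
  have h : (2 * ((ζ ^ 2).re : ℂ)) = ζ ^ 2 + conj (ζ ^ 2) := by
    rw [Complex.add_conj]; push_cast; ring
  rw [chordReflection, h, ← ω_sq, map_pow, map_pow, conj_ω]
  linear_combination (ω ^ 38 + ω ^ 24 + ω ^ 10) * ω_pow_fourteen

/-- The chord is a + b = κ + 1. The reflection turns the lines of the three replaced edges into the
two axes and a + b = κ. -/
theorem chordReflection_coord (a b : ℝ) : chordReflection (toT (a * ω + b * ω ^ 4)) =
    toT ((κ + 1 - b : ℝ) * ω + (κ + 1 - a : ℝ) * ω ^ 4) := by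
  rw [chordReflection_eq, toT, toT, ← ω_sq]
  simp only [map_add, map_one, map_mul, map_sub, map_pow, conj_ω, conj_ofReal]
  have h2 : (ω ^ 13) ^ 2 = ω ^ 12 := by linear_combination ω ^ 12 * ω_pow_fourteen
  have h4 : (ω ^ 13) ^ 4 = ω ^ 10 := by
    linear_combination (ω ^ 38 + ω ^ 24 + ω ^ 10) * ω_pow_fourteen
  rw [h2, h4, ω_pow_12, ω_pow_13, ω_pow_10]
  push_cast
  have h7 := ω_pow_seven
  have hk := one_add_ω_sq
  have hk' := mul_ω_pow_four
  linear_combination (ω ^ 2 - 1) * hk - (ω ^ 2 - 1) * hk'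
    - (1 + a * ω ^ 4 + b * ω) * h7

/-- The axes cut the tile into two triangles with the acute vertices and the triangle a, b ≥ 0, a +
b ≤ κ. -/
theorem mem_heptagon_of_mem_P {z : ℂ} (hz : z ∈ P) : toT z ∈ heptagon := by
  have h1 := s₁_pos
  have h2 := s₂_pos
  have h3 := s₃_pos
  have hκ := κ_pos
  have e1 := κ_add_one_mul_s₁
  have e3 := κ_mul_s₃
  have e4 : s₁ * s₃ + s₁ * s₂ = s₂ * s₃ := by linear_combination (-s₁) * e3 + s₃ * e1
  obtain ⟨a, b, rfl⟩ := exists_coord z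
  obtain ⟨z0, z1, z5, z6, z234⟩ := hz
  rw [side_0_coord] at z0
  rw [side_1_coord] at z1
  rw [side_5_coord] at z5
  rw [side_6_coord] at z6
  rw [side_2_coord, side_3_coord, side_4_coord] at z234
  have hk : (κ + 1 : ℝ) = s₂ / s₁ := by field_simp; exact e1
  by_cases hb : b ≤ 0
  -- The barycentric weights are sides 1, 2 and 0, each divided by its value at the opposite vertex.
  · have := triangle_mem_heptagon toT_mem_0 toT_mem_1 toT_mem_2
      (a := (s₂ + b * s₂ - a * s₁) / s₂) (b := -b * s₃ / s₁) (c := (a * s₁ + b * s₃) / s₂)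
      (by positivity) (div_nonneg (by nlinarith) h1.le) (by positivity)
      (by field_simp; linear_combination b * e4)
    convert this using 2
    have h1' : (s₁ : ℂ) ≠ 0 := by exact_mod_cast h1.ne'
    have h2' : (s₂ : ℂ) ≠ 0 := by exact_mod_cast h2.ne'
    have h3' : (s₃ : ℂ) ≠ 0 := by exact_mod_cast h3.ne'
    rw [one_eq_coord, hk]
    push_cast
    field_simp
    ring
  by_cases ha : a ≤ 0
  · have := triangle_mem_heptagon toT_mem_0 toT_mem_6 toT_mem_5
      (a := (s₂ + a * s₂ - b * s₁) / s₂) (b := -a * s₃ / s₁) (c := (a * s₃ + b * s₁) / s₂)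
      (by positivity) (div_nonneg (by nlinarith) h1.le) (by positivity)
      (by field_simp; linear_combination a * e4)
    convert this using 2
    have h1' : (s₁ : ℂ) ≠ 0 := by exact_mod_cast h1.ne'
    have h2' : (s₂ : ℂ) ≠ 0 := by exact_mod_cast h2.ne'
    have h3' : (s₃ : ℂ) ≠ 0 := by exact_mod_cast h3.ne'
    rw [ω_pow_five_eq_coord, hk]
    push_cast
    field_simp
    ring
  push Not at ha hb
  have hab : a + b ≤ κ := by
    rcases z234 with h | h | h
    · nlinarith
    · by_contra! hc
      nlinarith
    · nlinarith
  exact toT_mem_heptagon_of_coord ha.le hb.le (by linarith) (by linarith) (by linarith)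

/-- A point of the heptagon outside the tile has a, b > 0 and a + b > κ, and the reflection puts it
into the pentagon of `toT_mem_heptagon_of_coord`; so it belongs to the removed heptagon. Conversely
interior points of the tile violate one of the reflected edge bounds, and the closure supplies the
boundary. -/
theorem T_eq_image : T = toT '' P := by
  have h2 := s₂_pos
  have h3 := s₃_pos
  apply subset_antisymm
  · have hcl : IsClosed (toT '' P) := by
      have : toT '' P = ((Homeomorph.mulLeft₀ (ζ - 1) ζ_sub_one_ne_zero).trans
        (Homeomorph.addLeft 1)) '' P := rfl
      rw [this]
      exact (Homeomorph.isClosed_image _).2 isClosed_P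
    refine closure_minimal ?_ hcl
    rintro y ⟨hy, hy'⟩
    obtain ⟨z, rfl⟩ := toT_surj y
    refine ⟨z, ?_, rfl⟩
    obtain ⟨⟨z0, z1, z5, z6⟩, z2, z3, z4⟩ := heptagon_subset hy
    refine ⟨z0, z1, z5, z6, ?_⟩
    by_contra! h
    apply hy'
    obtain ⟨a, b, rfl⟩ := exists_coord z
    rw [side_2_coord] at z2 h
    rw [side_3_coord] at z3 h
    rw [side_4_coord] at z4 h
    refine ⟨toT ((κ + 1 - b : ℝ) * ω + (κ + 1 - a : ℝ) * ω ^ 4), ?_, ?_⟩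
    · have k2 : b ≤ κ + 1 := le_of_mul_le_mul_right (by linarith) h3
      have k4 : a ≤ κ + 1 := le_of_mul_le_mul_right (by linarith) h3
      have l2 : 0 < b := pos_of_mul_pos_left (by linarith : 0 < b * s₃) h3.le
      have l4 : 0 < a := pos_of_mul_pos_left (by linarith : 0 < a * s₃) h3.le
      have l3 : 0 < a + b - κ := pos_of_mul_pos_left (by linarith : 0 < (a + b - κ) * s₂) h2.le
      exact toT_mem_heptagon_of_coord (by linarith) (by linarith) (by linarith) (by linarith)
        (by linarith)
    · rw [chordReflection_coord]
      congr 3 <;> simp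
  · have hsub : toT '' Pint ⊆ heptagon \ chordReflection '' heptagon := by
      rintro _ ⟨z, hz, rfl⟩
      refine ⟨mem_heptagon_of_mem_P (Pint_subset_P hz), ?_⟩
      rintro ⟨y, hy, hyz⟩
      obtain ⟨w, rfl⟩ := toT_surj y
      obtain ⟨-, w2, w3, w4⟩ := heptagon_subset hy
      obtain ⟨a, b, rfl⟩ := exists_coord w
      rw [chordReflection_coord] at hyz
      rw [← toT_inj hyz] at hz
      obtain ⟨-, -, -, -, h⟩ := hz
      rw [side_2_coord] at w2 h
      rw [side_3_coord] at w3 h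
      rw [side_4_coord] at w4 h
      rcases h with h | h | h <;> linarith
    calc toT '' P ⊆ toT '' closure Pint := Set.image_mono P_subset_closure_Pint
      _ ⊆ closure (toT '' Pint) := image_closure_subset_closure_image continuous_toT
      _ ⊆ T := closure_mono hsub

theorem T_eq_tile : T = tile 1 (ζ - 1) := T_eq_image

/-! ### Copies of the tile -/

/-- The similarity that places the normalized tile. -/
noncomputable def placing (p : ℂ) {w : ℂ} (hw : w ≠ 0) : ℂ ≃ₜ ℂ :=
  (Homeomorph.mulLeft₀ w hw).trans (Homeomorph.addLeft p)

theorem tile_eq_placing (p : ℂ) {w : ℂ} (hw : w ≠ 0) : tile p w = placing p hw '' P := rfl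

theorem isClosed_tile (p : ℂ) {w : ℂ} (hw : w ≠ 0) : IsClosed (tile p w) :=
  (placing p hw).isClosed_image.2 isClosed_P

theorem mem_interior_tile {p w : ℂ} (hw : w ≠ 0) {z : ℂ} (hz : z ∈ interior P) :
    p + w * z ∈ interior (tile p w) := by
  rw [tile_eq_placing p hw, ← (placing p hw).image_interior]
  exact ⟨z, hz, rfl⟩

theorem mem_frontier_tile {p w : ℂ} (hw : w ≠ 0) {z : ℂ} (hz : z ∈ frontier P) :
    p + w * z ∈ frontier (tile p w) := by
  rw [tile_eq_placing p hw, ← (placing p hw).image_frontier]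
  exact ⟨z, hz, rfl⟩

theorem exists_of_mem_frontier_tile {p w : ℂ} (hw : w ≠ 0) {y : ℂ} (hy : y ∈ frontier (tile p w)) :
    ∃ (j : Fin 7) (τ : ℝ), 0 ≤ τ ∧ τ ≤ 1 ∧ y = p + w * edgePt j τ := by
  rw [tile_eq_placing p hw, ← (placing p hw).image_frontier] at hy
  obtain ⟨z, hz, rfl⟩ := hy
  obtain ⟨j, τ, h0, h1, rfl⟩ := mem_edge_of_mem_frontier hz
  exact ⟨j, τ, h0, h1, rfl⟩

theorem tile_subset_closure_interior (p : ℂ) {w : ℂ} (hw : w ≠ 0) :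
    tile p w ⊆ closure (interior (tile p w)) := by
  rw [tile_eq_placing p hw, ← (placing p hw).image_interior, ← (placing p hw).image_closure,
    interior_P]
  exact Set.image_mono P_subset_closure_Pint

/-! ### Isometries and the mirror symmetry of the tile. -/

theorem exists_isometry_form (f : ℂ ≃ᵢ ℂ) : ∃ a b : ℂ, ‖a‖ = 1 ∧
    ((∀ z, f z = a * z + b) ∨ (∀ z, f z = a * conj z + b)) := by
  obtain ⟨a, h | h⟩ := linear_isometry_complex f.toRealLinearIsometryEquiv
  · refine ⟨a, f 0, Circle.norm_coe a, Or.inl fun z => ?_⟩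
    have := congrArg (fun g => g z) h
    simp only [IsometryEquiv.toRealLinearIsometryEquiv_apply, rotation_apply] at this
    rw [← this]; ring
  · refine ⟨a, f 0, Circle.norm_coe a, Or.inr fun z => ?_⟩
    have := congrArg (fun g => g z) h
    simp only [IsometryEquiv.toRealLinearIsometryEquiv_apply, LinearIsometryEquiv.trans_apply,
      rotation_apply, conjLIE_apply] at this
    rw [← this]; ring

theorem ω_pow_five_mul_conj_coord (a b : ℝ) :
    ω ^ 5 * conj (a * ω + b * ω ^ 4) = b * ω + a * ω ^ 4 := by
  simp only [map_add, map_mul, map_pow, conj_ω, conj_ofReal]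
  have h4 : (ω ^ 13) ^ 4 = ω ^ 10 := by
    linear_combination (ω ^ 38 + ω ^ 24 + ω ^ 10) * ω_pow_fourteen
  rw [h4]
  linear_combination (a * ω ^ 4 + b * ω) * ω_pow_fourteen

/-- The map exchanges the two coordinates, hence sides 0 and 6, 1 and 5, 2 and 4, and it preserves
side 3. -/
theorem mirror_mem_P {z : ℂ} (hz : z ∈ P) : ω ^ 5 * conj z ∈ P := by
  obtain ⟨a, b, rfl⟩ := exists_coord z
  rw [ω_pow_five_mul_conj_coord]
  obtain ⟨h0, h1, h5, h6, h⟩ := hz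
  rw [side_0_coord] at h0
  rw [side_1_coord] at h1
  rw [side_5_coord] at h5
  rw [side_6_coord] at h6
  rw [side_2_coord, side_3_coord, side_4_coord] at h
  refine ⟨?_, ?_, ?_, ?_, ?_⟩
  · rw [side_0_coord]; linarith
  · rw [side_1_coord]; linarith
  · rw [side_5_coord]; linarith
  · rw [side_6_coord]; linarith
  · rw [side_2_coord, side_3_coord, side_4_coord]
    rcases h with h | h | h
    · exact .inr (.inr h)
    · exact .inr (.inl (by linarith))
    · exact .inl h

theorem image_tile {f : ℂ → ℂ} {a b : ℂ} (hf : ∀ z, f z = a * z + b) (p w : ℂ) :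
    f '' tile p w = tile (a * p + b) (a * w) := by
  rw [tile, tile, Set.image_image]
  congr 1
  funext z
  rw [hf]; ring

/-- The symmetry of the tile absorbs the reflection; `ω ^ 9` is the inverse of its factor `ω ^ 5`.
-/
theorem image_tile_conj {f : ℂ → ℂ} {a b : ℂ} (hf : ∀ z, f z = a * conj z + b) (p w : ℂ) :
    f '' tile p w = tile (a * conj p + b) (a * (conj w * ω ^ 9)) := by
  ext y
  simp only [tile, Set.image_image, Set.mem_image]
  constructor
  · rintro ⟨z, hz, rfl⟩
    refine ⟨_, mirror_mem_P hz, ?_⟩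
    rw [hf, map_add, map_mul]
    linear_combination (a * conj w * conj z) * ω_pow_fourteen
  · rintro ⟨z, hz, rfl⟩
    refine ⟨_, mirror_mem_P hz, ?_⟩
    rw [hf, map_add, map_mul, map_mul, conj_conj, map_pow, conj_ω]
    have h : (ω ^ 13) ^ 5 = ω ^ 9 := by
      linear_combination (ω ^ 51 + ω ^ 37 + ω ^ 23 + ω ^ 9) * ω_pow_fourteen
    rw [h]; ring

/-- The copy of the tile for which the point at distance `τ` on the edge `j` is `q`, with the edge
pointing in the direction of `u`. -/
noncomputable def place (j : Fin 7) (τ : ℝ) (q u : ℂ) : Set ℂ :=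
  tile (q - u * ω ^ (14 - dir j) * edgePt j τ) (u * ω ^ (14 - dir j))

theorem mul_ω_pow_ne_zero {u : ℂ} (hu : u ≠ 0) (n : ℕ) : u * ω ^ n ≠ 0 :=
  mul_ne_zero hu (pow_ne_zero _ ω_ne_zero)

theorem place_shift (j : Fin 7) (τ r : ℝ) (q u : ℂ) :
    place j (τ + r) (q + r * u) u = place j τ q u := by
  have : edgePt j (τ + r) = edgePt j τ + r * ω ^ dir j := by
    unfold edgePt; push_cast; ring
  rw [place, place, this]
  congr 1
  linear_combination -(u * r) * ω_pow_dir_mul j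

theorem eq_place (j : Fin 7) (τ : ℝ) (p w : ℂ) :
    tile p w = place j τ (p + w * edgePt j τ) (w * ω ^ dir j) := by
  have : w * ω ^ dir j * ω ^ (14 - dir j) = w := by
    linear_combination w * ω_pow_dir_mul j
  rw [place, this]
  congr 1; ring

theorem eventually_mem_interior_place (j : Fin 7) {τ : ℝ} (h0 : 0 ≤ τ) (h1 : τ < 1) {k : ℕ}
    (hk : 0 < k) (hk' : k < angAt j τ) (q : ℂ) {u : ℂ} (hu : u ≠ 0) :
    ∀ᶠ r : ℝ in 𝓝[>] 0, q + r * (u * ω ^ k) ∈ interior (place j τ q u) := by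
  filter_upwards [eventually_mem_interior j h0 h1 hk hk'] with r hr
  have := mem_interior_tile (p := q - u * ω ^ (14 - dir j) * edgePt j τ)
    (mul_ω_pow_ne_zero hu (14 - dir j)) hr
  rw [place]
  convert this using 1
  rw [pow_add]
  linear_combination -(r * u * ω ^ k) * ω_pow_dir_mul j

theorem mem_frontier_place (j : Fin 7) {τ r : ℝ} (h0 : 0 ≤ τ + r) (h1 : τ + r ≤ 1) (q : ℂ) {u : ℂ}
    (hu : u ≠ 0) : q + r * u ∈ frontier (place j τ q u) := by
  rw [← place_shift j τ r]
  have := mem_frontier_tile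
    (p := q + r * u - u * ω ^ (14 - dir j) * edgePt j (τ + r))
    (mul_ω_pow_ne_zero hu (14 - dir j)) (edgePt_mem_frontier j h0 h1)
  rw [place]
  convert this using 1
  ring

/-- A tile placed by its edge `j` is also placed by the next edge. -/
theorem place_one (j : Fin 7) (q u : ℂ) :
    place j 1 q u = place (j + 1) 0 q (u * ω ^ (21 - ang (j + 1))) := by
  have h7 := ω_pow_seven
  have h14 := ω_pow_fourteen
  -- The boundary turns by 7 - ang units; adding the full turn 14 keeps the exponent natural at
  -- reflex vertices.
  have hdir : ω ^ (21 - ang (j + 1)) * ω ^ (14 - dir (j + 1)) = ω ^ (14 - dir j) := by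
    rw [← pow_add]
    fin_cases j <;> simp [ang, dir]
    · linear_combination ω ^ 14 * h14
    · linear_combination ω ^ 12 * h14
    · linear_combination ω ^ 6 * h14
    · linear_combination ω ^ 8 * h14
    · linear_combination (ω ^ 10) * h14
    · linear_combination ω ^ 4 * h14
    · linear_combination (ω ^ 16 + ω ^ 2) * h14
  have hvert : vert (j + 1) = vert j + ω ^ dir j := by
    fin_cases j <;> simp [vert, dir]
    · linear_combination -ω_pow_8
    · linear_combination -cyclotomic
    · linear_combination -ω_pow_10
    · linear_combination -ω_pow_12
  rw [place, place, mul_assoc u (ω ^ (21 - _)), hdir, edgePt, edgePt, hvert]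
  simp

/-! ### Tilings -/

theorem exists_eq_tile {𝒯 : Set (Set ℂ)} (h𝒯 : IsMonohedralTiling T 𝒯) {A : Set ℂ}
    (hA : A ∈ 𝒯) : ∃ p w : ℂ, ‖w‖ = ‖ζ - 1‖ ∧ A = tile p w := by
  obtain ⟨f, rfl⟩ := h𝒯.copies A hA
  obtain ⟨a, b, ha, hf | hf⟩ := exists_isometry_form f
  · exact ⟨a * 1 + b, a * (ζ - 1), by rw [norm_mul, ha, one_mul],
      by rw [T_eq_tile, image_tile hf]⟩
  · exact ⟨a * conj 1 + b, a * (conj (ζ - 1) * ω ^ 9), by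
      rw [norm_mul, ha, one_mul, norm_mul, norm_pow, norm_ω, one_pow, mul_one, RCLike.norm_conj],
      by rw [T_eq_tile, image_tile_conj hf]⟩

theorem ne_zero_of_norm_eq {w : ℂ} (hw : ‖w‖ = ‖ζ - 1‖) : w ≠ 0 := by
  rw [← norm_pos_iff, hw, norm_pos_iff]
  exact ζ_sub_one_ne_zero

theorem eq_of_mem_interior {𝒯 : Set (Set ℂ)} (h𝒯 : IsMonohedralTiling T 𝒯) {A B : Set ℂ}
    (hA : A ∈ 𝒯) (hB : B ∈ 𝒯) {z : ℂ} (hzA : z ∈ interior A) (hzB : z ∈ interior B) : A = B := by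
  by_contra hne
  have h0 := h𝒯.no_overlap A hA B hB hne
  have hpos : 0 < volume (interior A ∩ interior B) :=
    (isOpen_interior.inter isOpen_interior).measure_pos _ ⟨z, hzA, hzB⟩
  exact (hpos.trans_le (measure_mono
    (Set.inter_subset_inter interior_subset interior_subset))).ne' h0

/-- Every tile is contained in the closure of its interior, so near such a point the two interiors
would meet. -/
theorem not_mem_frontier {𝒯 : Set (Set ℂ)} (h𝒯 : IsMonohedralTiling T 𝒯) {A B : Set ℂ}
    (hA : A ∈ 𝒯) (hB : B ∈ 𝒯) {z : ℂ} (hzA : z ∈ interior A) (hzB : z ∈ frontier B) : False := by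
  obtain ⟨p, w, hw, rfl⟩ := exists_eq_tile h𝒯 hB
  have hw0 := ne_zero_of_norm_eq hw
  have hz : z ∈ closure (interior (tile p w)) := tile_subset_closure_interior p hw0
    ((isClosed_tile p hw0).frontier_subset hzB)
  obtain ⟨y, hyA, hyB⟩ := mem_closure_iff.1 hz _ isOpen_interior hzA
  have := eq_of_mem_interior h𝒯 hA hB hyA hyB
  subst this
  exact disjoint_interior_frontier.le_bot ⟨hzA, hzB⟩

/-! ### Local finiteness and the neighbours of a tile. -/

theorem exists_norm_bound : ∃ M, ∀ z ∈ P, ‖z‖ ≤ M := by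
  have hb : Bornology.IsBounded heptagon :=
    ((Set.finite_range _).isCompact_convexHull (𝕜 := ℝ)).isBounded
  obtain ⟨M, hM⟩ := isBounded_iff_forall_norm_le.1 hb
  refine ⟨(M + 1) / ‖ζ - 1‖, fun z hz => ?_⟩
  have h1 := hM _ (mem_heptagon_of_mem_P hz)
  have h2 : (ζ - 1) * z = toT z - 1 := by unfold toT; ring
  rw [le_div_iff₀ (norm_pos_iff.2 ζ_sub_one_ne_zero), mul_comm, ← norm_mul, h2]
  calc ‖toT z - 1‖ ≤ ‖toT z‖ + ‖(1 : ℂ)‖ := norm_sub_le _ _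
    _ ≤ M + 1 := by rw [norm_one]; linarith

theorem nonempty_interior_P : (interior P).Nonempty := by
  have h0 : (0 : ℂ) ∈ P := by
    have := edgePt_mem_frontier 0 le_rfl zero_le_one
    have h := isClosed_P.frontier_subset this
    simpa [edgePt, vert] using h
  have := P_subset_closure_Pint h0
  rw [← interior_P] at this
  exact closure_nonempty_iff.1 ⟨_, this⟩

/-- A tiling is locally finite. -/
theorem finite_tiles_near {𝒯 : Set (Set ℂ)} (h𝒯 : IsMonohedralTiling T 𝒯) (q : ℂ) :
    {A ∈ 𝒯 | (A ∩ Metric.ball q 1).Nonempty}.Finite := by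
  obtain ⟨M, hM⟩ := exists_norm_bound
  obtain ⟨z₀, hz₀⟩ := nonempty_interior_P
  obtain ⟨δ, hδ, hball⟩ := Metric.isOpen_iff.1 isOpen_interior z₀ hz₀
  set ρ := ‖ζ - 1‖
  have hρ : 0 < ρ := norm_pos_iff.2 ζ_sub_one_ne_zero
  set S := {A ∈ 𝒯 | (A ∩ Metric.ball q 1).Nonempty}
  -- Packing argument: the disjoint interiors contain discs of one fixed size, and they all lie in
  -- one bounded disc.
  have hvol : ∀ A : S, volume (Metric.ball (0 : ℂ) (ρ * δ)) ≤ volume (interior (A : Set ℂ)) := by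
    rintro ⟨A, hA, -⟩
    obtain ⟨p, w, hw, rfl⟩ := exists_eq_tile h𝒯 hA
    have hw0 := ne_zero_of_norm_eq hw
    have hsub : Metric.ball (p + w * z₀) (ρ * δ) ⊆ interior (tile p w) := by
      intro y hy
      have hy' : (y - p) / w ∈ interior P := by
        apply hball
        rw [Metric.mem_ball, dist_eq_norm] at hy ⊢
        have : (y - p) / w - z₀ = (y - (p + w * z₀)) / w := by field_simp; ring
        rw [this, norm_div, hw, div_lt_iff₀ hρ, mul_comm δ]
        exact hy
      have := mem_interior_tile (p := p) hw0 hy'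
      convert this using 1
      field_simp; ring
    calc volume (Metric.ball (0 : ℂ) (ρ * δ)) = volume (Metric.ball (p + w * z₀) (ρ * δ)) := by
          rw [Complex.volume_ball, Complex.volume_ball]
      _ ≤ _ := measure_mono hsub
  have hunion : (⋃ A : S, interior (A : Set ℂ)) ⊆ Metric.ball q (1 + ρ * M + ρ * M + 1) := by
    refine Set.iUnion_subset ?_
    rintro ⟨A, hA, ⟨x, hxA, hxq⟩⟩ y hy
    obtain ⟨p, w, hw, rfl⟩ := exists_eq_tile h𝒯 hA
    obtain ⟨x', hx', rfl⟩ := hxA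
    obtain ⟨y', hy', rfl⟩ := interior_subset hy
    rw [Metric.mem_ball, dist_eq_norm] at hxq ⊢
    have e : p + w * y' - q = (p + w * x' - q) + (w * y' - w * x') := by ring
    simp only at hxq ⊢
    rw [e]
    have hn : ∀ v ∈ P, ‖w * v‖ ≤ ρ * M := fun v hv => by
      rw [norm_mul, hw]; exact mul_le_mul_of_nonneg_left (hM v hv) hρ.le
    have h1 := hn x' hx'
    have h2 := hn y' hy'
    have h3 := norm_add_le (p + w * x' - q) (w * y' - w * x')
    have h4 := norm_sub_le (w * y') (w * x')
    linarith
  have hdisj : Pairwise (Function.onFun Disjoint fun A : S => interior (A : Set ℂ)) := by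
    intro A B hAB
    rw [Function.onFun, Set.disjoint_left]
    intro z hzA hzB
    exact hAB (Subtype.ext (eq_of_mem_interior h𝒯 A.2.1 B.2.1 hzA hzB))
  have hfin := Measure.finite_const_le_meas_of_disjoint_iUnion (volume : Measure ℂ)
    (ε := volume (Metric.ball (0 : ℂ) (ρ * δ)))
    (Metric.measure_ball_pos _ _ (by positivity)) (As := fun A : S => interior (A : Set ℂ))
    (fun A => isOpen_interior.measurableSet) hdisj
    ((measure_mono hunion).trans_lt measure_ball_lt_top).ne
  have huniv : {A : S | volume (Metric.ball (0 : ℂ) (ρ * δ)) ≤ volume (interior (A : Set ℂ))} =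
      Set.univ := Set.eq_univ_of_forall hvol
  rw [huniv, Set.finite_univ_iff] at hfin
  exact Set.toFinite S

/-- Every boundary point of a tile belongs to the boundary of another tile. -/
theorem exists_other_tile {𝒯 : Set (Set ℂ)} (h𝒯 : IsMonohedralTiling T 𝒯) {A : Set ℂ}
    (hA : A ∈ 𝒯) {z : ℂ} (hz : z ∈ frontier A) : ∃ B ∈ 𝒯, B ≠ A ∧ z ∈ frontier B := by
  have hfin := finite_tiles_near h𝒯 z
  have hclosed : ∀ B ∈ 𝒯, IsClosed B := fun B hB => by
    obtain ⟨p, w, hw, rfl⟩ := exists_eq_tile h𝒯 hB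
    exact isClosed_tile p (ne_zero_of_norm_eq hw)
  set F := {B ∈ 𝒯 | (B ∩ Metric.ball z 1).Nonempty} \ {A}
  have hF : F.Finite := hfin.subset Set.sdiff_subset
  -- Points outside `A` accumulate at `z`, and near `z` they are covered by the finitely many other
  -- tiles, whose union is closed.
  have hcl : IsClosed (⋃ B ∈ F, B) := hF.isClosed_biUnion fun B hB => hclosed B hB.1.1
  have hmem : z ∈ ⋃ B ∈ F, B := by
    rw [← hcl.closure_eq, mem_closure_iff]
    intro U hU hzU
    have hz' : z ∈ closure Aᶜ := (frontier_eq_closure_inter_closure (s := A) ▸ hz).2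
    obtain ⟨y, ⟨hyU, hyb⟩, hyA⟩ := mem_closure_iff.1 hz' _ (hU.inter Metric.isOpen_ball)
      ⟨hzU, Metric.mem_ball_self one_pos⟩
    obtain ⟨B, hB, hyB⟩ : ∃ B ∈ 𝒯, y ∈ B := by
      have : y ∈ ⋃₀ 𝒯 := h𝒯.covers ▸ Set.mem_univ y
      exact this
    refine ⟨y, hyU, Set.mem_biUnion (x := B) ⟨⟨hB, y, hyB, hyb⟩, ?_⟩ hyB⟩
    rintro rfl
    exact hyA hyB
  obtain ⟨B, ⟨⟨hB, -⟩, hBA⟩, hzB⟩ := Set.mem_iUnion₂.1 hmem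
  refine ⟨B, hB, hBA, ?_⟩
  rw [(hclosed B hB).frontier_eq]
  exact ⟨hzB, fun h => not_mem_frontier h𝒯 hB hA h hz⟩

/-- If a tile ends at a ray, then some tile starts there on the other side. -/
theorem exists_next {𝒯 : Set (Set ℂ)} (h𝒯 : IsMonohedralTiling T 𝒯) {i : Fin 7} {τ : ℝ} {q u : ℂ}
    (hA : place i τ q (-u) ∈ 𝒯) (hu : ‖u‖ = ‖ζ - 1‖) (h0 : 0 < τ) (h1 : τ ≤ 1) :
    ∃ (j : Fin 7) (σ : ℝ), 0 ≤ σ ∧ σ < 1 ∧ place j σ q u ∈ 𝒯 := by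
  have hu0 := ne_zero_of_norm_eq hu
  have hneg : -u ≠ 0 := neg_ne_zero.2 hu0
  set A := place i τ q (-u) with hAdef
  have hshift : ∀ r : ℝ, A = place i (τ - r) (q + r * u) (-u) := fun r => by
    rw [hAdef, ← place_shift i τ (-r)]
    congr 1; push_cast; ring
  have hray : ∀ r : ℝ, 0 < r → r < τ → q + r * u ∈ frontier A := fun r hr hrτ => by
    have := mem_frontier_place i (τ := τ) (r := -r) (by linarith) (by linarith) q hneg
    convert this using 1
    push_cast; ring
  have hfin := finite_tiles_near h𝒯 q
  set F := {B ∈ 𝒯 | (B ∩ Metric.ball q 1).Nonempty}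
  have hlim : Tendsto (fun r : ℝ => q + r * u) (𝓝[>] 0) (𝓝 q) := by
    have : Continuous (fun r : ℝ => q + r * u) := by fun_prop
    have := this.tendsto 0
    simp only [Complex.ofReal_zero, zero_mul, add_zero] at this
    exact this.mono_left nhdsWithin_le_nhds
  have hev : ∀ᶠ r : ℝ in 𝓝[>] 0, ∃ B ∈ F, B ≠ A ∧ q + r * u ∈ frontier B := by
    filter_upwards [Ioo_mem_nhdsGT h0, hlim.eventually (Metric.ball_mem_nhds q one_pos)]
      with r hr hrq
    obtain ⟨B, hB, hBA, hBf⟩ := exists_other_tile h𝒯 hA (hray r hr.1 hr.2)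
    refine ⟨B, ⟨hB, _, ?_, hrq⟩, hBA, hBf⟩
    obtain ⟨p, w, hw, rfl⟩ := exists_eq_tile h𝒯 hB
    exact (isClosed_tile p (ne_zero_of_norm_eq hw)).frontier_subset hBf
  -- Finitely many tiles, then finitely many edges: one edge contains points of the ray arbitrarily
  -- close to `q`. Two of them fix its direction up to sign.
  obtain ⟨B, hBF, hBA, hfreq⟩ : ∃ B ∈ F, B ≠ A ∧ ∃ᶠ r : ℝ in 𝓝[>] 0, q + r * u ∈ frontier B := by
    by_contra! hcon
    have : ∀ᶠ r : ℝ in 𝓝[>] 0, ∀ B ∈ F, B ≠ A → q + r * u ∉ frontier B := by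
      rw [eventually_all_finite hfin]
      intro B hB
      by_cases hBA : B = A
      · exact Eventually.of_forall fun r h => absurd hBA h
      · filter_upwards [hcon B hB hBA] with r hr _ using hr
    obtain ⟨r, ⟨B, hB, hBA, hBf⟩, hr⟩ := (hev.and this).exists
    exact hr B hB hBA hBf
  have hB := hBF.1
  obtain ⟨p, w, hw, rfl⟩ := exists_eq_tile h𝒯 hB
  have hw0 := ne_zero_of_norm_eq hw
  obtain ⟨j, hj⟩ : ∃ j : Fin 7, ∃ᶠ r : ℝ in 𝓝[>] 0, ∃ t : ℝ, 0 ≤ t ∧ t ≤ 1 ∧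
      q + r * u = p + w * edgePt j t := by
    by_contra! hcon
    have : ∀ᶠ r : ℝ in 𝓝[>] 0, ∀ j : Fin 7, ¬ ∃ t : ℝ, 0 ≤ t ∧ t ≤ 1 ∧
        q + r * u = p + w * edgePt j t :=
      eventually_all.2 fun j => by
        filter_upwards [hcon j] with r hr
        rintro ⟨t, h0, h1, h⟩
        exact hr t h0 h1 h
    obtain ⟨r, hr, hr'⟩ := (hfreq.and_eventually this).exists
    obtain ⟨j, t, h0, h1, h⟩ := exists_of_mem_frontier_tile hw0 hr
    exact hr' j ⟨t, h0, h1, h⟩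
  have hsmall : ∀ ε : ℝ, 0 < ε → ∃ r : ℝ, 0 < r ∧ r < ε ∧ ∃ t : ℝ, 0 ≤ t ∧ t ≤ 1 ∧
      q + r * u = p + w * edgePt j t := fun ε hε => by
    obtain ⟨r, hr, hr'⟩ := (hj.and_eventually (Ioo_mem_nhdsGT hε)).exists
    exact ⟨r, hr'.1, hr'.2, hr⟩
  obtain ⟨r₁, hr₁, hr₁τ, t₁, ht₁0, ht₁1, e₁⟩ := hsmall τ h0
  obtain ⟨r₂, hr₂, hr₂₁, t₂, ht₂0, ht₂1, e₂⟩ := hsmall r₁ hr₁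
  have ediff : ((r₁ - r₂ : ℝ) : ℂ) * u = ((t₁ - t₂ : ℝ) : ℂ) * (w * ω ^ dir j) := by
    unfold edgePt at e₁ e₂
    push_cast
    linear_combination e₁ - e₂
  have hnorm : |r₁ - r₂| = |t₁ - t₂| := by
    have := congrArg norm ediff
    rw [norm_mul, norm_mul, norm_mul, norm_pow, norm_ω, one_pow, mul_one, hw, hu,
      Complex.norm_real, Complex.norm_real] at this
    exact mul_right_cancel₀ (norm_ne_zero_iff.2 ζ_sub_one_ne_zero) this
  have hrne : ((r₁ - r₂ : ℝ) : ℂ) ≠ 0 := by exact_mod_cast (sub_pos.2 hr₂₁).ne'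
  rcases abs_eq_abs.1 hnorm with h | h
  · have huw : u = w * ω ^ dir j := by
      rw [← h] at ediff
      exact mul_left_cancel₀ hrne ediff
    have heq : tile p w = place j (t₁ - r₁) q u := by
      have h₁ : p + w * edgePt j (t₁ - r₁) = q := by
        unfold edgePt at e₁ ⊢
        push_cast
        linear_combination -e₁ + r₁ * huw
      rw [eq_place j (t₁ - r₁), h₁, ← huw]
    refine ⟨j, t₁ - r₁, ?_, by linarith, heq ▸ hB⟩
    by_contra! hlt
    obtain ⟨r, hr, hr', t, ht0, ht1, e⟩ := hsmall (r₁ - t₁) (by linarith)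
    have : ((t - r : ℝ) : ℂ) * u = ((t₁ - r₁ : ℝ) : ℂ) * u := by
      unfold edgePt at e₁ e
      push_cast
      linear_combination -e + e₁ + (t - t₁) * huw
    have : t - r = t₁ - r₁ := by exact_mod_cast mul_right_cancel₀ hu0 this
    linarith
  · have huw : -u = w * ω ^ dir j := by
      have : t₁ - t₂ = -(r₁ - r₂) := by linarith
      rw [this] at ediff
      push_cast at ediff hrne
      apply mul_left_cancel₀ hrne
      linear_combination -ediff
    -- With the opposite sign `B` lies on the same side of the ray as `A`. The outer radii `r₁`,
    -- `r₃` force 0 < t₂ < 1, so the second point is inside edges of both tiles, and their interiors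
    -- overlap.
    obtain ⟨r₃, hr₃, hr₃₂, t₃, ht₃0, ht₃1, e₃⟩ := hsmall r₂ hr₂
    have ht : t₃ + r₃ = t₂ + r₂ := by
      have : ((t₃ + r₃ : ℝ) : ℂ) * u = ((t₂ + r₂ : ℝ) : ℂ) * u := by
        unfold edgePt at e₂ e₃
        push_cast
        linear_combination e₃ - e₂ - (t₃ - t₂) * huw
      exact_mod_cast mul_right_cancel₀ hu0 this
    exfalso
    apply hBA
    have heq : tile p w = place j t₂ (q + r₂ * u) (-u) := by
      rw [eq_place j t₂, ← e₂, huw]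
    have k3 : ∀ (j : Fin 7) (t : ℝ), 0 < t → 3 < angAt j t := fun j t ht => by
      rw [angAt, if_neg ht.ne']; norm_num
    have evA := eventually_mem_interior_place i (τ := τ - r₂) (by linarith) (by linarith)
      (k := 3) (by norm_num) (k3 i _ (by linarith)) (q + r₂ * u) hneg
    have evB := eventually_mem_interior_place j (τ := t₂) (by linarith) (by linarith)
      (k := 3) (by norm_num) (k3 j _ (by linarith)) (q + r₂ * u) hneg
    rw [← hshift] at evA
    rw [← heq] at evB
    obtain ⟨r, hrA, hrB⟩ := (evA.and evB).exists
    exact eq_of_mem_interior h𝒯 hB hA hrB hrA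

/-- A tile cannot start at a ray that enters the inner angle of another tile. -/
theorem not_start_in_angle {𝒯 : Set (Set ℂ)} (h𝒯 : IsMonohedralTiling T 𝒯) {i j : Fin 7}
    {τ σ : ℝ} {q u : ℂ} {k : ℕ} (hA : place i τ q u ∈ 𝒯) (hB : place j σ q (u * ω ^ k) ∈ 𝒯)
    (hu : u ≠ 0) (hτ0 : 0 ≤ τ) (hτ1 : τ < 1) (hσ0 : 0 ≤ σ) (hσ1 : σ < 1) (hk : 0 < k)
    (hk' : k < angAt i τ) : False := by
  have ev := eventually_mem_interior_place i hτ0 hτ1 hk hk' q hu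
  obtain ⟨r, hr, hr'⟩ := (ev.and (Ioo_mem_nhdsGT (sub_pos.2 hσ1))).exists
  exact not_mem_frontier h𝒯 hA hB hr
    (mem_frontier_place j (by linarith [hr'.1]) (by linarith [hr'.2]) q (mul_ω_pow_ne_zero hu k))

/-! ### Fitting tiles into a wedge -/

/-- Passing to the next vertex. -/
theorem place_next (j : Fin 7) (q v : ℂ) :
    place j 0 q v = place (j + 1) 0 (q + v) (v * ω ^ (21 - ang (j + 1))) := by
  rw [← place_one, ← place_shift j 0 1]
  simp

/-- The tile that starts at a ray with an inner angle ends at the other arm of the angle. -/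
theorem place_other_arm (j : Fin 7) (q v : ℂ) :
    place (j + 1) 0 q v = place j 1 q (-(v * ω ^ ang (j + 1))) := by
  rw [place_one]
  congr 1
  have h : ω ^ ang (j + 1) * ω ^ (21 - ang (j + 1)) = ω ^ 21 := by
    rw [← pow_add]; congr 1; fin_cases j <;> rfl
  have h21 : ω ^ 21 = -1 := by linear_combination ω ^ 7 * ω_pow_fourteen + ω_pow_seven
  linear_combination v * h + v * h21

theorem place_reverse (j : Fin 7) (q v : ℂ) :
    place j 1 q (-v) = place j 0 (q + v) (-v) := by
  have := place_shift j 0 1 (q + v) (-v)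
  simpa using this

theorem norm_mul_ω_pow (v : ℂ) (n : ℕ) : ‖v * ω ^ n‖ = ‖v‖ := by
  rw [norm_mul, norm_pow, norm_ω, one_pow, mul_one]

variable {𝒯 : Set (Set ℂ)}

/-- Two tiles on both sides of an edge cannot both have a reflex angle at its endpoint. -/
theorem not_reflex_reflex (h𝒯 : IsMonohedralTiling T 𝒯) {i j : Fin 7} {q v : ℂ} (hv : v ≠ 0)
    (hj : ang j = 9) (hi : ang (i + 1) = 9) (hA : place j 1 q (-v) ∈ 𝒯)
    (hB : place i 0 q v ∈ 𝒯) : False := by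
  -- At the far end the next edge of the second tile makes 5 units with the common edge, inside the
  -- 9 units of the first tile.
  rw [place_reverse] at hA
  rw [place_next, hi] at hB
  have e : v * ω ^ (21 - 9) = -v * ω ^ 5 := by
    norm_num only
    rw [ω_pow_12]; ring
  rw [e] at hB
  exact not_start_in_angle h𝒯 hA hB (neg_ne_zero.2 hv) le_rfl one_pos le_rfl one_pos
    (by norm_num) (by rw [angAt, if_pos rfl, hj]; norm_num)

/-- The first tile in a wedge. -/
theorem exists_next_in_wedge (h𝒯 : IsMonohedralTiling T 𝒯) {i i' : Fin 7} {τ : ℝ} {q v : ℂ}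
    {k : ℕ} (hv : ‖v‖ = ‖ζ - 1‖) (hA : place i τ q (-v) ∈ 𝒯) (h0 : 0 < τ) (h1 : τ ≤ 1)
    (hB : place i' 0 q (v * ω ^ k) ∈ 𝒯) (hk : 0 < k) :
    ∃ (j : Fin 7) (σ : ℝ), 0 ≤ σ ∧ σ < 1 ∧ place j σ q v ∈ 𝒯 ∧ angAt j σ ≤ k := by
  obtain ⟨j, σ, hσ0, hσ1, h⟩ := exists_next h𝒯 hA hv h0 h1
  refine ⟨j, σ, hσ0, hσ1, h, ?_⟩
  by_contra! hlt
  exact not_start_in_angle h𝒯 h hB (ne_zero_of_norm_eq hv) hσ0 hσ1 le_rfl one_pos hk hlt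

/-- A wedge below π has no room for the straight angle at an interior point of an edge. -/
theorem exists_vertex_in_wedge (h𝒯 : IsMonohedralTiling T 𝒯) {i i' : Fin 7} {τ : ℝ} {q v : ℂ}
    {k : ℕ} (hv : ‖v‖ = ‖ζ - 1‖) (hA : place i τ q (-v) ∈ 𝒯) (h0 : 0 < τ) (h1 : τ ≤ 1)
    (hB : place i' 0 q (v * ω ^ k) ∈ 𝒯) (hk : 0 < k) (hk' : k < 7) :
    ∃ j : Fin 7, place j 0 q v ∈ 𝒯 ∧ ang j ≤ k := by
  obtain ⟨j, σ, -, -, h, ha⟩ := exists_next_in_wedge h𝒯 hv hA h0 h1 hB hk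
  by_cases hσ : σ = 0
  · subst hσ
    rw [angAt, if_pos rfl] at ha
    exact ⟨j, h, ha⟩
  · rw [angAt, if_neg hσ] at ha
    omega

/-- Only the angle π/7 fits. The alternatives are its orientations: concave edge on the given ray,
or on the other arm of the acute angle. -/
theorem acute_in_wedge (h𝒯 : IsMonohedralTiling T 𝒯) {i i' : Fin 7} {τ : ℝ} {q v : ℂ}
    {k : ℕ} (hv : ‖v‖ = ‖ζ - 1‖) (hA : place i τ q (-v) ∈ 𝒯) (h0 : 0 < τ) (h1 : τ ≤ 1)
    (hB : place i' 0 q (v * ω ^ k) ∈ 𝒯) (hk : 0 < k) (hk' : k ≤ 4) :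
    place 2 0 q v ∈ 𝒯 ∨ place 4 1 q (-(v * ω)) ∈ 𝒯 := by
  obtain ⟨j, h, ha⟩ := exists_vertex_in_wedge h𝒯 hv hA h0 h1 hB hk (by omega)
  fin_cases j <;> simp [ang] at ha <;> try omega
  · exact Or.inl h
  · right
    have := place_other_arm 4 q v
    rw [show ang (4 + 1) = 1 from rfl, pow_one] at this
    rw [← this]; exact h

/-- Acute angles cannot fill a wedge of at most `4π/7` between two concave edges. -/
theorem no_wedge (h𝒯 : IsMonohedralTiling T 𝒯) {i j : Fin 7} (hj : ang j = 9)
    (hi : ang (i + 1) = 9) {q v : ℂ} {k : ℕ} (hk : k ≤ 4) (hv : ‖v‖ = ‖ζ - 1‖)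
    (hA : place j 1 q (-v) ∈ 𝒯) (hB : place i 0 q (v * ω ^ k) ∈ 𝒯) : False := by
  induction k generalizing j v with
  | zero =>
    rw [pow_zero, mul_one] at hB
    exact not_reflex_reflex h𝒯 (ne_zero_of_norm_eq hv) hj hi hA hB
  | succ k ih =>
    -- A concave edge on the first arm collides at once; otherwise the acute tile becomes the new
    -- first arm and the wedge shrinks by one unit.
    rcases acute_in_wedge h𝒯 hv hA one_pos le_rfl hB k.succ_pos hk with h | h
    · exact not_reflex_reflex h𝒯 (i := 2) (ne_zero_of_norm_eq hv) hj rfl hA h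
    · refine ih (j := 4) (v := v * ω) rfl (by omega) ?_ h ?_
      · simpa using (norm_mul_ω_pow v 1).trans hv
      · rw [mul_assoc, ← pow_succ']; exact hB

/-- The acute angles in a wedge that ends with a concave edge all have the same orientation. -/
theorem last_in_wedge (h𝒯 : IsMonohedralTiling T 𝒯) {i : Fin 7} {τ : ℝ} {q v : ℂ} {k : ℕ}
    (hk : k + 1 ≤ 4) (hv : ‖v‖ = ‖ζ - 1‖) (hA : place i τ q (-v) ∈ 𝒯) (h0 : 0 < τ) (h1 : τ ≤ 1)
    (hB : place 2 0 q (v * ω ^ (k + 1)) ∈ 𝒯) : place 2 0 q (v * ω ^ k) ∈ 𝒯 := by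
  induction k generalizing i τ v with
  | zero =>
    rw [pow_zero, mul_one]
    rcases acute_in_wedge h𝒯 hv hA h0 h1 hB one_pos hk with h | h
    · exact h
    · refine (no_wedge h𝒯 (i := 2) (j := 4) rfl rfl (k := 0) (by omega) (v := v * ω) ?_ h ?_).elim
      · simpa using (norm_mul_ω_pow v 1).trans hv
      · simpa using hB
  | succ k ih =>
    have hv' : ‖v * ω‖ = ‖ζ - 1‖ := by simpa using (norm_mul_ω_pow v 1).trans hv
    have hB' : place 2 0 q (v * ω * ω ^ (k + 1)) ∈ 𝒯 := by
      rw [mul_assoc, ← pow_succ']; exact hB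
    rcases acute_in_wedge h𝒯 hv hA h0 h1 hB (by omega) hk with h | h
    · have e := place_other_arm 1 q v
      rw [show ang (1 + 1) = 1 from rfl, pow_one] at e
      have := ih (i := 1) (τ := 1) (v := v * ω) (by omega) hv' (e ▸ h) one_pos le_rfl hB'
      rwa [mul_assoc, ← pow_succ'] at this
    · exact (no_wedge h𝒯 (i := 2) (j := 4) rfl rfl (by omega) hv' h hB').elim

/-! ### Tiles facing each other -/

/-- The cases are the vertex `j` placed at `p`: acute (2, 5), outer obtuse (1, 6) or middle obtuse
(0). `hE'` reads the first tile from its reflex vertex `p + u`, where 5 units are open. -/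
theorem not_facing_five (h𝒯 : IsMonohedralTiling T 𝒯) {p u : ℂ} (hu : ‖u‖ = ‖ζ - 1‖)
    (hE : place 4 1 p (-u) ∈ 𝒯) (hD : place 2 0 p (u * ω ^ 5) ∈ 𝒯) : False := by
  have hu0 := ne_zero_of_norm_eq hu
  have h7 := ω_pow_seven
  obtain ⟨j, h, ha⟩ := exists_vertex_in_wedge h𝒯 hu hE one_pos le_rfl hD (by norm_num) (by norm_num)
  have hE' : place 3 1 (p + u) (-(u * ω ^ 2)) ∈ 𝒯 := by
    have e := place_other_arm 3 (p + u) (-u)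
    rw [place_reverse] at hE
    rw [show (3 : Fin 7) + 1 = 4 from rfl, show ang 4 = 9 from rfl] at e
    rw [e] at hE
    convert hE using 2
    linear_combination (-u * ω ^ 2) * h7
  fin_cases j <;> simp [ang] at ha
  -- The inserted tile also fills the open angle at `p + u`, so its acute vertex lies at the next
  -- reflex vertex `q` of the first tile and leaves 4 units open.
  · change place 0 0 p u ∈ 𝒯 at h
    set q := p + u + u * ω ^ 2 with hq
    have hQ : place 2 0 q (u * ω ^ 4 * ω ^ (3 + 1)) ∈ 𝒯 := by
      rw [place_next, place_next] at h
      simp only [Fin.isValue, Fin.reduceAdd, ang, Matrix.cons_val, Nat.reduceSub] at h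
      convert h using 2
      · grind
      · grind
    have hR : place 2 1 q (-(u * ω ^ 4)) ∈ 𝒯 := by
      have e := place_other_arm 2 q (-(u * ω ^ 2))
      rw [place_reverse, ← hq] at hE'
      rw [show (2 : Fin 7) + 1 = 3 from rfl, show ang 3 = 9 from rfl] at e
      rw [e] at hE'
      convert hE' using 2
      linear_combination (-u * ω ^ 4) * h7
    have ht := last_in_wedge h𝒯 (by norm_num) ((norm_mul_ω_pow u 4).trans hu) hR one_pos le_rfl hQ
    rw [place_next, place_next, place_next, place_next] at ht
    rw [place_next, place_next] at hD
    simp only [Fin.isValue, Fin.reduceAdd] at ht hD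
    simp only [ang, Fin.isValue, Matrix.cons_val, Nat.reduceSub] at ht hD
    -- Following both boundaries, vertex 6 of the last acute tile at `q` falls on reflex vertex 4 of
    -- the second given tile, whose edge 4 enters the angle there.
    refine not_start_in_angle h𝒯 (i := 6) (τ := 0) (q := p + u * (ω ^ 3 + ω ^ 5))
      (u := u * ω ^ 11) (j := 4) (σ := 0) (k := 4) ?_ ?_ (mul_ω_pow_ne_zero hu0 _) le_rfl one_pos
      le_rfl one_pos (by norm_num) (by rw [angAt, if_pos rfl]; decide)
    · convert ht using 2
      · grind
      · grind
    · convert hD using 2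
      · grind
      · grind
  -- The acute vertex of the inserted tile lies at the reflex vertex `p + u`: constellation a. The
  -- case of vertex 6 is its mirror image at `p + u * ω ^ 5`.
  · refine no_wedge h𝒯 (i := 2) (j := 3) rfl rfl (k := 4) le_rfl
      ((norm_mul_ω_pow u 2).trans hu) hE' ?_
    change place 1 0 p u ∈ 𝒯 at h
    rw [place_next] at h
    simp only [Fin.isValue, Fin.reduceAdd, ang, Matrix.cons_val, Nat.reduceSub] at h
    convert h using 2
    linear_combination (-u * ω ^ 6) * ω_pow_fourteen
  · exact not_reflex_reflex h𝒯 (i := 2) hu0 rfl rfl hE h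
  · have e := place_other_arm 4 p u
    rw [show (4 : Fin 7) + 1 = 5 from rfl, show ang 5 = 1 from rfl, pow_one] at e
    change place 5 0 p u ∈ 𝒯 at h
    rw [e] at h
    refine no_wedge h𝒯 (i := 2) (j := 4) rfl rfl (k := 4) le_rfl
      (by simpa using (norm_mul_ω_pow u 1).trans hu) h ?_
    convert hD using 2
    ring
  · have e := place_other_arm 5 p u
    change place 6 0 p u ∈ 𝒯 at h
    rw [show (5 : Fin 7) + 1 = 6 from rfl, show ang 6 = 5 from rfl] at e
    rw [e, place_reverse] at h
    have e' := place_other_arm 4 (p + u * ω ^ 5) (-(u * ω ^ 5))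
    rw [show (4 : Fin 7) + 1 = 5 from rfl, show ang 5 = 1 from rfl] at e'
    rw [e'] at h
    refine no_wedge h𝒯 (i := 3) (j := 4) (v := -(u * ω ^ 5) * ω ^ 1) rfl rfl (k := 4) le_rfl
      (by rw [norm_mul_ω_pow, norm_neg, norm_mul_ω_pow, hu]) h ?_
    rw [place_next] at hD
    simp only [Fin.isValue, Fin.reduceAdd, ang, Matrix.cons_val, Nat.reduceSub] at hD
    convert hD using 2
    linear_combination (-u * ω ^ 10) * h7

/-- In a facing pair with an open angle of more than `5π/7`, no tile has an angle of `5π/7`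
at the edge of the first tile. -/
theorem not_facing_of_five (h𝒯 : IsMonohedralTiling T 𝒯) {p u : ℂ} (hu : ‖u‖ = ‖ζ - 1‖) {k : ℕ}
    (hk : k < 4) (hE : place 4 1 p (-u) ∈ 𝒯) (hD : place 2 0 p (u * ω ^ (5 + (k + 1))) ∈ 𝒯)
    {j : Fin 7} (hj : ang (j + 1) = 5) (h : place (j + 1) 0 p u ∈ 𝒯) : False := by
  rw [place_other_arm, hj] at h
  have hv : ‖u * ω ^ 5‖ = ‖ζ - 1‖ := (norm_mul_ω_pow u 5).trans hu
  have hD' : place 2 0 p (u * ω ^ 5 * ω ^ (k + 1)) ∈ 𝒯 := by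
    rwa [mul_assoc, ← pow_add]
  rcases acute_in_wedge h𝒯 hv h one_pos le_rfl hD' k.succ_pos (by omega) with h' | h'
  -- This acute tile faces the first tile across exactly the 5 units just filled.
  · exact not_facing_five h𝒯 hu hE h'
  · refine no_wedge h𝒯 (i := 2) (j := 4) rfl rfl (k := k) (by omega) (v := u * ω ^ 5 * ω) ?_ h' ?_
    · simpa using (norm_mul_ω_pow (u * ω ^ 5) 1).trans hv
    · rwa [mul_assoc, ← pow_succ']

/-- The step from a facing pair to a facing pair with a smaller open angle. -/
theorem facing_step (h𝒯 : IsMonohedralTiling T 𝒯) {p u : ℂ} (hu : ‖u‖ = ‖ζ - 1‖) {k : ℕ}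
    (hk : k < 3) (hE : place 4 1 p (-u) ∈ 𝒯) (hD : place 2 0 p (u * ω ^ (5 + (k + 1))) ∈ 𝒯)
    {j : Fin 7} (h : place j 0 p u ∈ 𝒯) (ha : ang j ≤ 5 + (k + 1)) :
    place 4 1 p (-(u * ω)) ∈ 𝒯 := by
  -- The open angle is at most 8 units, which excludes both reflex vertices.
  fin_cases j <;> simp [ang] at ha <;> try omega
  · exact (not_facing_of_five h𝒯 hu (by omega) hE hD (j := 6) rfl h).elim
  · exact (not_facing_of_five h𝒯 hu (by omega) hE hD (j := 0) rfl h).elim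
  · exact (not_reflex_reflex h𝒯 (i := 2) (ne_zero_of_norm_eq hu) rfl rfl hE h).elim
  · have e := place_other_arm 4 p u
    rw [show (4 : Fin 7) + 1 = 5 from rfl, show ang 5 = 1 from rfl, pow_one] at e
    rw [← e]; exact h
  · exact (not_facing_of_five h𝒯 hu (by omega) hE hD (j := 5) rfl h).elim

theorem not_facing_six (h𝒯 : IsMonohedralTiling T 𝒯) {p u : ℂ} (hu : ‖u‖ = ‖ζ - 1‖)
    (hE : place 4 1 p (-u) ∈ 𝒯) (hD : place 2 0 p (u * ω ^ 6) ∈ 𝒯) : False := by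
  obtain ⟨j, h, ha⟩ := exists_vertex_in_wedge h𝒯 hu hE one_pos le_rfl hD (by norm_num) (by norm_num)
  refine not_facing_five h𝒯 (u := u * ω) ?_
    (facing_step h𝒯 hu (k := 0) (by norm_num) hE hD h ha) ?_
  · simpa using (norm_mul_ω_pow u 1).trans hu
  · rwa [mul_assoc, ← pow_succ']

/-- Besides the vertex case, a straight edge can fill the half-plane at `p`. Its endpoint `a` then
lies inside the first tile's edge. -/
theorem not_facing_seven (h𝒯 : IsMonohedralTiling T 𝒯) {p u : ℂ} (hu : ‖u‖ = ‖ζ - 1‖)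
    (hE : place 4 1 p (-u) ∈ 𝒯) (hD : place 2 0 p (u * ω ^ 7) ∈ 𝒯) : False := by
  have hu0 := ne_zero_of_norm_eq hu
  have hn0 := neg_ne_zero.2 hu0
  obtain ⟨j, σ, hσ0, hσ1, h, ha⟩ := exists_next_in_wedge h𝒯 hu hE one_pos le_rfl hD (by norm_num)
  rcases hσ0.eq_or_lt' with rfl | hσ
  · rw [angAt, if_pos rfl] at ha
    refine not_facing_six h𝒯 (u := u * ω) ?_
      (facing_step h𝒯 hu (k := 1) (by norm_num) hE hD h ha) ?_
    · simpa using (norm_mul_ω_pow u 1).trans hu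
    · rwa [mul_assoc, ← pow_succ']
  set a := p + (1 - σ : ℝ) * u with hadef
  have hS : place (j + 1) 0 a (u * ω ^ (21 - ang (j + 1))) ∈ 𝒯 := by
    rw [← place_one]
    rw [← place_shift j σ (1 - σ)] at h
    convert h using 2
    ring
  have hE1 : place 4 σ a (-u) ∈ 𝒯 := by
    rw [← place_shift 4 1 (σ - 1)] at hE
    convert hE using 2
    · ring
    · rw [hadef]; push_cast; ring
  have hang : ∀ (i : Fin 7) (t : ℝ), 0 < t → angAt i t = 7 := fun i t ht => by
    rw [angAt, if_neg ht.ne']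
  -- The tile continuing from `a` has a vertex there. Its edge has full length but only the fraction
  -- σ < 1 remains up to the reflex vertex `p + u`, so it runs on into the 9 units of the first
  -- tile.
  have next : ∀ k : ℕ, 0 < k → k < 7 → place (j + 1) 0 a (u * ω ^ k) ∈ 𝒯 → False := by
    intro k hk hk' hS'
    obtain ⟨j', σ', hσ'0, hσ'1, h', ha'⟩ := exists_next_in_wedge h𝒯 hu hE1 hσ hσ1.le hS' hk
    rcases hσ'0.eq_or_lt' with rfl | hσ'
    · rw [place_reverse] at hE
      rw [← place_shift j' 0 σ] at h'
      refine not_start_in_angle h𝒯 (k := 7) (j := j') (σ := 0 + σ) hE ?_ hn0 le_rfl one_pos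
        (by linarith) (by linarith) (by norm_num) (by rw [angAt, if_pos rfl]; decide)
      convert h' using 2
      · rw [hadef]; push_cast; ring
      · rw [ω_pow_seven]; ring
    · rw [hang _ _ hσ'] at ha'
      omega
  have hcases : ang (j + 1) = 1 ∨ ang (j + 1) = 5 ∨ ang (j + 1) = 9 := by
    fin_cases j <;> decide
  -- Angles 1 and 5 at `a` leave wedges of 6 and 2 units; angle 9 exceeds the half-plane and
  -- overlaps the first tile.
  rcases hcases with e | e | e <;> rw [e] at hS <;> norm_num only at hS
  · rw [ω_pow_20] at hS
    exact next 6 (by norm_num) (by norm_num) hS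
  · rw [ω_pow_16] at hS
    exact next 2 (by norm_num) (by norm_num) hS
  · refine not_start_in_angle h𝒯 (k := 5) hE1 ?_ hn0 hσ.le hσ1 le_rfl one_pos (by norm_num)
      (by rw [hang _ _ hσ]; norm_num) (j := j + 1) (σ := 0)
    convert hS using 2
    rw [ω_pow_12]; ring

/-! ### The constellations -/

theorem exp_neg_eq_ω_pow (m : ℕ) : exp (-(m * Real.pi / 7 : ℝ) * I) = ω ^ (13 * m) := by
  have h : exp (-(m * Real.pi / 7 : ℝ) * I) * ω ^ m = 1 := by
    rw [ω, ← Complex.exp_nat_mul, ← Complex.exp_add, ← Complex.exp_zero]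
    congr 1
    push_cast; ring
  apply mul_right_cancel₀ (pow_ne_zero m ω_ne_zero)
  rw [h, ← pow_add, show 13 * m + m = 14 * m by ring, pow_mul, ω_pow_fourteen, one_pow]

theorem conj_ζ_sub_one : conj (ζ - 1) = (ζ - 1) * ω ^ 5 := by
  rw [← ω_sq, map_sub, map_pow, conj_ω, map_one]
  linear_combination ω ^ 12 * ω_pow_fourteen + (ω ^ 5 - 1) * ω_pow_seven

theorem conj_tip : conj tip = ω ^ 10 := by
  rw [tip, ← ω_sq, map_pow, map_pow, conj_ω]
  linear_combination (ω ^ 38 + ω ^ 24 + ω ^ 10) * ω_pow_fourteen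

theorem reflexVertex_sub_tip : reflexVertex - tip = (ζ - 1) * ω ^ 8 := by
  rw [reflexVertex, chordReflection_eq, tip, ← ω_sq, map_pow, map_pow, conj_ω]
  grind [ω_pow_seven]

theorem flipTurn_eq (m : ℕ) (z : ℂ) :
    flipTurn m z = ω ^ (13 * m + 11) * conj z + (tip - ω ^ (13 * m + 11) * ω ^ 10) := by
  have h : (reflexVertex - tip) / conj (reflexVertex - tip) = ω ^ 11 := by
    have h0 : conj (reflexVertex - tip) ≠ 0 := by
      rw [map_ne_zero]; exact sub_ne_zero.2 reflexVertex_ne_tip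
    rw [div_eq_iff h0, reflexVertex_sub_tip, map_mul, conj_ζ_sub_one, map_pow, conj_ω]
    grind [ω_pow_seven]
  rw [flipTurn, h, exp_neg_eq_ω_pow, map_sub, conj_tip]
  ring

theorem flipTurn_image (m : ℕ) : flipTurn m '' T =
    tile (ω ^ (13 * m + 11) + (tip - ω ^ (13 * m + 11) * ω ^ 10))
      (ω ^ (13 * m + 11) * (ζ - 1)) := by
  rw [T_eq_tile, image_tile_conj (flipTurn_eq m), conj_ζ_sub_one, map_one, mul_one]
  congr 1
  linear_combination ω ^ (13 * m + 11) * (ζ - 1) * ω_pow_fourteen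

theorem whiteTile_eq : whiteTile = tile (ω ^ 5 + (ω ^ 4 + ω ^ 10)) (ω ^ 5 * (ζ - 1)) := by
  have hf : ∀ z, chordReflection (ζ * z) = ω ^ 5 * conj z + (ω ^ 4 + ω ^ 10) := by
    intro z
    rw [chordReflection_eq, map_mul, ← ω_sq, map_pow, conj_ω]
    linear_combination (-(ω ^ 12) * conj z) * ω_pow_fourteen + (-(ω ^ 5) * conj z) * ω_pow_seven
  rw [whiteTile, T_eq_tile, image_tile_conj hf, conj_ζ_sub_one, map_one, mul_one]
  congr 1
  linear_combination ω ^ 5 * (ζ - 1) * ω_pow_fourteen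

theorem mem_of_image_tile {𝒯 : Set (Set ℂ)} {f : ℂ → ℂ} {a b p w : ℂ} (j : Fin 7) (τ : ℝ)
    {q v : ℂ} (h : f '' tile p w ∈ 𝒯) (hf : ∀ z, f z = a * z + b)
    (hq : a * (p + w * edgePt j τ) + b = q) (hv : a * w * ω ^ dir j = v) : place j τ q v ∈ 𝒯 := by
  rw [image_tile hf, eq_place j τ] at h
  convert h using 2
  · rw [← hq]; ring
  · exact hv.symm

theorem mem_of_image_tile_conj {𝒯 : Set (Set ℂ)} {f : ℂ → ℂ} {a b p w : ℂ} (j : Fin 7) (τ : ℝ)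
    {q v : ℂ} (h : f '' tile p w ∈ 𝒯) (hf : ∀ z, f z = a * conj z + b)
    (hq : a * (conj p + conj w * ω ^ 9 * edgePt j τ) + b = q)
    (hv : a * (conj w * ω ^ 9) * ω ^ dir j = v) : place j τ q v ∈ 𝒯 := by
  rw [image_tile_conj hf, eq_place j τ] at h
  convert h using 2
  · rw [← hq]; ring
  · exact hv.symm

/-- The pair is read counterclockwise: clockwise tile first, then the open angle. A reflection
reverses this order, so the two tiles exchange their roles. -/
theorem facing_of_occurs {m : ℕ} (h : Occurs (facingPair m) 𝒯) : ∃ p u : ℂ, ‖u‖ = ‖ζ - 1‖ ∧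
    place 4 1 p (-u) ∈ 𝒯 ∧ place 2 0 p (u * ω ^ m) ∈ 𝒯 := by
  obtain ⟨f, hf⟩ := h
  have h1 := hf T (by simp [facingPair])
  have h2 := hf (flipTurn m '' T) (by simp [facingPair])
  rw [T_eq_tile] at h1
  rw [flipTurn_image] at h2
  have hm : ω ^ (13 * m) * ω ^ m = 1 := by
    rw [← pow_add, show 13 * m + m = 14 * m by ring, pow_mul, ω_pow_fourteen, one_pow]
  have hc : conj (ω ^ (13 * m + 11)) = ω ^ m * ω ^ 3 := by
    rw [map_pow, conj_ω, ← pow_mul, ← pow_add, show 13 * (13 * m + 11) = 14 * (12 * m + 10) +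
      (m + 3) by ring, pow_add, pow_mul, ω_pow_fourteen, one_pow, one_mul]
  obtain ⟨a, b, ha, hab | hab⟩ := exists_isometry_form f
  · refine ⟨a * tip + b, a * (ζ - 1) * ω ^ (13 * m + 8), ?_, ?_, ?_⟩
    · rw [norm_mul_ω_pow, norm_mul, ha, one_mul]
    · refine mem_of_image_tile 4 1 h2 hab ?_ ?_
      · simp only [edgePt, vert, dir, Matrix.cons_val, tip, ← ω_sq, Complex.ofReal_one]
        have : 1 + (ω ^ 2 - 1) * (ω ^ 5 + ω ^ 3 - ω ^ 4 + 1 * ω ^ 4) = ω ^ 10 := by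
          linear_combination (1 - ω ^ 3) * ω_pow_seven
        linear_combination (a * ω ^ (13 * m + 11)) * this
      · simp only [dir, Matrix.cons_val]
        rw [pow_add, pow_add]
        linear_combination (a * ω ^ (13 * m) * (ζ - 1) * ω ^ 8) * ω_pow_seven
    · refine mem_of_image_tile 2 0 h1 hab ?_ ?_
      · simp only [edgePt, vert, dir, Matrix.cons_val, tip, ← ω_sq, Complex.ofReal_zero]
        ring
      · simp only [dir, Matrix.cons_val]
        rw [pow_add]
        linear_combination (-a * (ζ - 1) * ω ^ 8) * hm
  · refine ⟨a * ω ^ 10 + b, a * (ζ - 1) * ω ^ 11, ?_, ?_, ?_⟩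
    · rw [norm_mul_ω_pow, norm_mul, ha, one_mul]
    · refine mem_of_image_tile_conj 4 1 h1 hab ?_ ?_
      · rw [conj_ζ_sub_one]
        simp only [edgePt, vert, dir, Matrix.cons_val, ← ω_sq, Complex.ofReal_one, map_one]
        clear hm hc hab h1 h2 hf
        grind [ω_pow_seven]
      · rw [conj_ζ_sub_one]
        simp only [dir, Matrix.cons_val]
        clear hm hc hab h1 h2 hf
        grind [ω_pow_seven]
    · refine mem_of_image_tile_conj 2 0 h2 hab ?_ ?_
      · rw [map_mul, conj_ζ_sub_one, map_add, map_sub, map_mul, conj_tip, hc]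
        simp only [edgePt, vert, dir, Matrix.cons_val, ← ω_sq, Complex.ofReal_zero, map_pow, conj_ω]
        generalize ω ^ m = x
        clear hm hc hab h1 h2 hf
        grind [ω_pow_seven]
      · rw [map_mul, conj_ζ_sub_one, hc]
        simp only [dir, Matrix.cons_val]
        generalize ω ^ m = x
        clear hm hc hab h1 h2 hf
        grind [ω_pow_seven]

/-- The 4 open units lie between the white tile's concave edge and the middle concave edge of the
dark tile. Both have reflex far ends, so `no_wedge` applies. -/
theorem not_occurs_constellationA (h𝒯 : IsMonohedralTiling T 𝒯) : ¬ Occurs constellationA 𝒯 := by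
  rintro ⟨f, hf⟩
  have h1 := hf T (by simp [constellationA])
  have h2 := hf whiteTile (by simp [constellationA])
  rw [T_eq_tile] at h1
  rw [whiteTile_eq] at h2
  obtain ⟨a, b, ha, hab | hab⟩ := exists_isometry_form f
  · refine no_wedge h𝒯 (j := 4) (i := 3) rfl rfl (k := 4) le_rfl (v := a * (ζ - 1) * ω ^ 2)
      (q := a * (ω + ω ^ 4 + ω ^ 10) + b) ?_ ?_ ?_
    · rw [norm_mul_ω_pow, norm_mul, ha, one_mul]
    · refine mem_of_image_tile 4 1 h2 hab ?_ ?_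
      · simp only [edgePt, vert, dir, Matrix.cons_val, ← ω_sq, Complex.ofReal_one]
        clear hab h1 h2 hf
        grind [ω_pow_seven]
      · simp only [dir, Matrix.cons_val]
        clear hab h1 h2 hf
        grind [ω_pow_seven]
    · refine mem_of_image_tile 3 0 h1 hab ?_ ?_
      · simp only [edgePt, vert, dir, Matrix.cons_val, ← ω_sq, Complex.ofReal_zero]
        clear hab h1 h2 hf
        grind [ω_pow_seven]
      · simp only [dir, Matrix.cons_val]
        ring
  · refine no_wedge h𝒯 (j := 3) (i := 2) rfl rfl (k := 4) le_rfl (v := a * (ζ - 1) * ω ^ 13)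
      (q := a * (ω ^ 13 + ω ^ 10 + ω ^ 4) + b) ?_ ?_ ?_
    · rw [norm_mul_ω_pow, norm_mul, ha, one_mul]
    · refine mem_of_image_tile_conj 3 1 h1 hab ?_ ?_
      · rw [conj_ζ_sub_one]
        simp only [edgePt, vert, dir, Matrix.cons_val, ← ω_sq, Complex.ofReal_one, map_one]
        clear hab h1 h2 hf
        grind [ω_pow_seven, cyclotomic]
      · rw [conj_ζ_sub_one]
        simp only [dir, Matrix.cons_val]
        clear hab h1 h2 hf
        grind [ω_pow_seven]
    · refine mem_of_image_tile_conj 2 0 h2 hab ?_ ?_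
      · rw [map_mul, conj_ζ_sub_one]
        simp only [edgePt, vert, dir, Matrix.cons_val, ← ω_sq, Complex.ofReal_zero, map_pow, conj_ω,
          map_add]
        clear hab h1 h2 hf
        grind [ω_pow_seven]
      · rw [map_mul, conj_ζ_sub_one]
        simp only [dir, Matrix.cons_val, map_pow, conj_ω]
        clear hab h1 h2 hf
        grind [ω_pow_seven]

end HeptagonTile

open HeptagonTile in
theorem lemma3 (𝒯 : Set (Set ℂ)) (h𝒯 : IsMonohedralTiling T 𝒯) :
    ¬ Occurs constellationA 𝒯 ∧ ¬ Occurs constellationB 𝒯 ∧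
      ¬ Occurs constellationC 𝒯 ∧ ¬ Occurs constellationD 𝒯 := by
  refine ⟨not_occurs_constellationA h𝒯, fun h => ?_, fun h => ?_, fun h => ?_⟩
  · obtain ⟨p, u, hu, hE, hD⟩ := facing_of_occurs h
    exact not_facing_five h𝒯 hu hE hD
  · obtain ⟨p, u, hu, hE, hD⟩ := facing_of_occurs h
    exact not_facing_six h𝒯 hu hE hD
  · obtain ⟨p, u, hu, hE, hD⟩ := facing_of_occurs h
    exact not_facing_seven h𝒯 hu hE hD
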